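/- Let $\nu$ be a fixed probability law on $\mathbb{R}$ that is symmetric ($x \overset{d}{=} -x$ for $x\sim\nu$), has unit variance ($\int x^2\,d\nu=1$) and is subgaussian, i.e. there is $C>0$ with $\int |x|^k\,d\nu\le (Ck)^{k/2}$ for all integers $k\ge 1$. Let $N=N(n)$ be positive integers with $\gamma_n:=n/N\to\gamma\in(0,\infty)$ as $n\to\infty$, and let $p=p(n)\ge 1$ be integers with $p=o(n^{1/2})$. For each $n$ let $X$ be a random $n\times N$ matrix with i.i.d. entries of law $\nu$, and put $A=\frac1N XX^T$. For $c>0$ and integers $k\ge1$ let $$\beta(k,c)=\int_{(1-\sqrt c)^2}^{(1+\sqrt c)^2} x^k\,\frac{\sqrt{\big((1+\sqrt c)^2-x\big)\big(x-(1-\sqrt c)^2\big)}}{2\pi c\,x}\,dx$$ be the $k$-th Marchenko–Pastur moment. Then, as $n\to\infty$, $\operatorname{tr}(A^p)$ is integrable and $$\mathbb{E}[\operatorname{tr}(A^p)]=n\,\beta(p,\gamma_n)\,\Big(1+O\Big(\frac{p^2}{n}\Big)\Big),$$ where, for all integers $k\ge1$ and all $c>0$, $$\beta(k,c)=\sum_{r=0}^{k-1}\frac{1}{r+1}\binom{k}{r}\binom{k-1}{r}c^r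 .$$ -/

import Mathlib

open MeasureTheory ProbabilityTheory Filter Asymptotics
open scoped Matrix Topology

/-- A probability law `ν` on `ℝ` is subgaussian: all absolute moments are finite and there is
`C > 0` with `E|x|^k ≤ (C k)^(k/2)` for all `k ≥ 1`. -/
def IsSubgaussianLaw (ν : Measure ℝ) : Prop :=
  ∃ C : ℝ, 0 < C ∧ ∀ k : ℕ, 1 ≤ k →
    Integrable (fun x : ℝ => |x| ^ k) ν ∧
      ∫ x, |x| ^ k ∂ν ≤ (C * (k : ℝ)) ^ ((k : ℝ) / 2)

/-- A law on `ℝ` is symmetric: `x` and `-x` have the same distribution. -/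
def IsSymmetricLaw (ν : Measure ℝ) : Prop :=
  ν.map (fun x : ℝ => -x) = ν

/-- Left end point of the support of the absolutely continuous part of the
Marchenko–Pastur law of ratio `γ`. -/
noncomputable def mpLeft (γ : ℝ) : ℝ := (1 - √γ) ^ 2

/-- Right end point of the support of the Marchenko–Pastur law of ratio `γ`. -/
noncomputable def mpRight (γ : ℝ) : ℝ := (1 + √γ) ^ 2

open Classical in
/-- The Marchenko–Pastur density of ratio `γ`. -/
noncomputable def mpDensity (γ x : ℝ) : ℝ :=
  if x ∈ Set.Icc (mpLeft γ) (mpRight γ) then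
    √((mpRight γ - x) * (x - mpLeft γ)) / (2 * Real.pi * γ * x)
  else 0

/-- The `k`-th Marchenko–Pastur moment `β(k, γ)` (used for `k ≥ 1`). -/
noncomputable def mpMoment (k : ℕ) (γ : ℝ) : ℝ :=
  ∫ x in (mpLeft γ)..(mpRight γ), x ^ k * mpDensity γ x

/-- The matrix `A = (1/N) X Xᵀ` of an `n × N` matrix `X`. -/
noncomputable def sampleCov {n N : ℕ} (X : Matrix (Fin n) (Fin N) ℝ) :
    Matrix (Fin n) (Fin n) ℝ :=
  (1 / (N : ℝ)) • (X * Xᵀ)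

/-! The traces of powers of `X Xᵀ` satisfy a perturbed quadratic recursion, obtained by integrating
by parts in the entries; no counting of closed walks is needed.

Write `W = X Xᵀ`, `T_q = E tr W^q`, and `T'_q = E tr (Xᵀ X)^q`. For Gaussian entries, `E[x f] =
E[∂f]` applied to `tr W^(q+1) = ∑ X_ij (Xᵀ W^q)_ji` gives `T_(q+1) = ∑_a E[tr (Xᵀ X)^a tr W^(q-a)] +
q T_q`. For a subgaussian law, the moments are dominated by a sequence `domMoment C` for which the
same formula holds exactly with some monomials weighted by `C` (`momentFunctional_X_mul`). From
below, the true moments satisfy a one-sided version (`tiltedFunctional_zero_le`). Everything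
involved is a polynomial with natural coefficients, so inequalities need only be checked on
monomials.

Products of diagonal entries are decoupled by `tiltedFunctional_mul_le` and
`momentFunctional_mul_le`. The cost is paid by monomials that share a variable or contain the
differentiated one, and it sums to traces again (`sum_covarianceBound_le`). So `T_(q+1) ≈ ∑_a T'_a
T_(q-a)` up to a relative error `O(q/n)`. The unperturbed recursion is solved by `n N^q mpSeq (n/N)
q`, and summing the errors over `q ≤ p` gives the relative error `O(p²/n)` (`upper_of_recursion`,
`lower_of_recursion`).

It remains to identify `mpSeq` with the Marchenko–Pastur moments and the Narayana sum. All three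
satisfy one linear three-term recurrence with the same first value. -/

open Finset.HasAntidiagonal (antidiagonal)

/-! ### The quadratic recursion and its linear form -/

/-- The sequence determined by the quadratic recursion of the Marchenko–Pastur moments. -/
noncomputable def mpSeq (c : ℝ) : ℕ → ℝ
  | 0 => 1
  | q + 1 => ∑ a : Fin (q + 1), (if (a : ℕ) = 0 then 1 else c) * mpSeq c a * mpSeq c (q - a)

theorem mpSeq_zero (c : ℝ) : mpSeq c 0 = 1 := by rw [mpSeq]

theorem mpSeq_succ (c : ℝ) (q : ℕ) :
    mpSeq c (q + 1) = ∑ x ∈ antidiagonal q,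
      (if x.1 = 0 then 1 else c) * mpSeq c x.1 * mpSeq c x.2 := by
  rw [mpSeq, Finset.Nat.sum_antidiagonal_eq_sum_range_succ_mk, Finset.sum_range]

theorem mpSeq_one (c : ℝ) : mpSeq c 1 = 1 := by
  simp [mpSeq_succ, mpSeq_zero]

theorem mpSeq_succ' (c : ℝ) (q : ℕ) :
    mpSeq c (q + 1) = (1 - c) * mpSeq c q +
      c * ∑ x ∈ antidiagonal q, mpSeq c x.1 * mpSeq c x.2 := by
  rw [mpSeq_succ]
  have h : ∀ x : ℕ × ℕ, (if x.1 = 0 then 1 else c) * mpSeq c x.1 * mpSeq c x.2 =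
      (if x.1 = 0 then (1 - c) * mpSeq c x.2 else 0) + c * (mpSeq c x.1 * mpSeq c x.2) := by
    rintro ⟨a, b⟩
    by_cases ha : a = 0
    · subst ha; simp [mpSeq_zero]; ring
    · simp [ha]; ring
  simp_rw [h, Finset.sum_add_distrib, ← Finset.mul_sum]
  congr 1
  rw [Finset.Nat.sum_antidiagonal_eq_sum_range_succ_mk, Finset.sum_eq_single 0]
  · simp
  · intro b _ hb; simp [hb]
  · simp

/-- The generating function `g` solves a quadratic equation over power series. Completing the square
gives `F² = Q` with `F` affine in `g` and `Q` a quadratic polynomial, the discriminant.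
Differentiating yields the linear equation `2 Q F' = Q' F`, whose coefficients are the recurrence.
-/
theorem mpSeq_three_term {c : ℝ} (hc : c ≠ 0) (k : ℕ) :
    ((k : ℝ) + 3) * mpSeq c (k + 2) =
      (2 * k + 3) * (1 + c) * mpSeq c (k + 1) - k * (1 - c) ^ 2 * mpSeq c k := by
  open PowerSeries in
  set g : PowerSeries ℝ := PowerSeries.mk (mpSeq c) with hg
  have h1 : g = 1 + X * (C (1 - c) * g + C c * (g * g)) := by
    ext m
    rcases m with _ | m
    · simp [hg, mpSeq_zero]
    · rw [map_add, coeff_succ_X_mul, map_add, coeff_C_mul, coeff_C_mul, coeff_mul, coeff_one]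
      simp only [hg, coeff_mk, mpSeq_succ']
      simp
  set F : PowerSeries ℝ := C (2 * c) * (X * g) + C (1 - c) * X - 1 with hF
  set Q : PowerSeries ℝ := C ((1 - c) ^ 2) * X ^ 2 - C (2 * (1 + c)) * X + 1 with hQ
  have e2 : (C (2 : ℝ) : PowerSeries ℝ) = 2 := map_ofNat _ 2
  have e1 : (C (1 : ℝ) : PowerSeries ℝ) = 1 := map_one _
  have hFQ : F * F = Q := by
    simp only [hF, hQ, map_mul, map_sub, map_add, map_pow, e1, e2] at h1 ⊢
    linear_combination (-4 * C c * X) * h1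
  have hd : 2 * (Q * d⁄dX ℝ F) = d⁄dX ℝ Q * F := by
    rw [← hFQ]
    simp only [Derivation.leibniz, smul_eq_mul]
    ring
  have hdQ : d⁄dX ℝ Q = C (2 * (1 - c) ^ 2) * X - C (2 * (1 + c)) := by
    simp only [hQ, map_add, map_sub, Derivation.leibniz, derivative_C, derivative_X, smul_eq_mul,
      Derivation.map_one_eq_zero, pow_two]
    simp only [map_mul, e2]
    ring
  have hF1 : ∀ m, coeff (m + 2) F = 2 * c * mpSeq c (m + 1) := by
    intro m
    rw [hF, map_sub, map_add, coeff_C_mul, coeff_succ_X_mul, coeff_C_mul, coeff_X, coeff_one, hg,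
      coeff_mk]
    simp
  -- The factor `m` hides the coefficient of `X` in `F`, which is `1 + c` and breaks the pattern.
  have hF0 : ∀ m : ℕ, (m : ℝ) * coeff (m + 1) F = m * (2 * c * mpSeq c m) := by
    rintro (_ | m)
    · simp
    · rw [hF1]
  rw [hdQ, hQ] at hd
  have key := congrArg (coeff (k + 2)) hd
  have r1 : (2 : PowerSeries ℝ) * ((C ((1 - c) ^ 2) * X ^ 2 - C (2 * (1 + c)) * X + 1) *
      d⁄dX ℝ F) = C (2 * (1 - c) ^ 2) * (X * (X * d⁄dX ℝ F)) - C (4 * (1 + c)) * (X * d⁄dX ℝ F)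
        + C 2 * d⁄dX ℝ F := by
    rw [show (4 : ℝ) * (1 + c) = 2 * (2 * (1 + c)) by ring]
    simp only [map_mul, e2]; ring
  have r2 : (C (2 * (1 - c) ^ 2) * X - C (2 * (1 + c))) * F =
      C (2 * (1 - c) ^ 2) * (X * F) - C (2 * (1 + c)) * F := by ring
  rw [r1, r2] at key
  simp only [map_add, map_sub, coeff_C_mul, coeff_succ_X_mul, coeff_derivative] at key
  have s1 := hF1 (k + 1)
  have s2 := hF1 k
  have s3 := hF0 k
  push_cast at key s1 s2 s3
  have hc2 : (2 * c) ≠ 0 := by simpa using hc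
  apply mul_left_cancel₀ hc2
  rw [show k + 1 + 2 = k + 2 + 1 by ring, show k + 1 + 1 = k + 2 by ring] at s1
  rw [s1, s2] at key
  linear_combination key / 2 - (1 - c) ^ 2 * s3

/-! ### Narayana numbers and polynomials -/

theorem choose_succ_cast (n r : ℕ) :
    ((r : ℝ) + 1) * (n.choose (r + 1) : ℝ) = ((n : ℝ) - r) * (n.choose r : ℝ) := by
  rcases le_or_gt r n with h | h
  · have := Nat.choose_succ_right_eq n r
    have h2 : ((n.choose (r + 1) * (r + 1) : ℕ) : ℝ) = ((n.choose r * (n - r) : ℕ) : ℝ) := by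
      rw [this]
    push_cast [Nat.cast_sub h] at h2
    linarith
  · simp [Nat.choose_eq_zero_of_lt h, Nat.choose_eq_zero_of_lt (Nat.lt_succ_of_lt h)]

/-- The Narayana numbers `C(k+1,r) C(k,r) / (r+1)`. -/
noncomputable def narayanaCoeff (k r : ℕ) : ℝ :=
  1 / ((r : ℝ) + 1) * ((k + 1).choose r : ℝ) * (k.choose r : ℝ)

theorem narayanaCoeff_eq_zero {k r : ℕ} (h : k < r) : narayanaCoeff k r = 0 := by
  simp [narayanaCoeff, Nat.choose_eq_zero_of_lt h]

theorem narayanaCoeff_zero (k : ℕ) : narayanaCoeff k 0 = 1 := by simp [narayanaCoeff]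

theorem narayanaCoeff_one (k : ℕ) : narayanaCoeff k 1 = (k + 1) * k / 2 := by
  simp [narayanaCoeff]; ring


/-- Clears the row `k` of Pascal's triangle, so that in the recurrence below every binomial
coefficient reduces to row `k + 1`. -/
theorem succ_mul_narayanaCoeff (k s : ℕ) :
    ((k : ℝ) + 1) * narayanaCoeff k s =
      ((k : ℝ) + 1 - s) * ((k + 1).choose s : ℝ) ^ 2 / (s + 1) := by
  have h : ((k : ℝ) + 1 - s) * ((k + 1).choose s : ℝ) = (k + 1) * (k.choose s : ℝ) := by
    rcases le_or_gt s (k + 1) with hh | hh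
    · have := Nat.choose_mul_succ_eq k s
      have h2 : ((k.choose s * (k + 1) : ℕ) : ℝ) = (((k + 1).choose s * (k + 1 - s) : ℕ) : ℝ) := by
        rw [this]
      push_cast [Nat.cast_sub hh] at h2
      linarith
    · simp [Nat.choose_eq_zero_of_lt hh, Nat.choose_eq_zero_of_lt (Nat.lt_of_succ_lt hh)]
  simp only [narayanaCoeff]
  linear_combination (-(1 / ((s : ℝ) + 1)) * ((k + 1).choose s : ℝ)) * h

/-- After Pascal's rule every term is a rational multiple of the square of the single binomial `V`,
and a rational identity in `k` and `r` remains. -/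
theorem narayanaCoeff_three_term (k r : ℕ) :
    ((k : ℝ) + 4) * narayanaCoeff (k + 2) (r + 2) =
      (2 * k + 5) * (narayanaCoeff (k + 1) (r + 2) + narayanaCoeff (k + 1) (r + 1)) -
      (k + 1) * (narayanaCoeff k (r + 2) - 2 * narayanaCoeff k (r + 1) + narayanaCoeff k r) := by
  have e0 := succ_mul_narayanaCoeff k r
  have e1 := succ_mul_narayanaCoeff k (r + 1)
  have e2 := succ_mul_narayanaCoeff k (r + 2)
  have c1 := choose_succ_cast (k + 1) r
  have c2 := choose_succ_cast (k + 1) (r + 1)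
  have hr1 : (r : ℝ) + 1 ≠ 0 := by positivity
  have hr2 : (r : ℝ) + 2 ≠ 0 := by positivity
  have hr3 : (r : ℝ) + 3 ≠ 0 := by positivity
  have p1 : ((k + 2).choose (r + 1) : ℝ) = (k + 1).choose r + (k + 1).choose (r + 1) := by
    exact_mod_cast Nat.choose_succ_succ (k + 1) r
  have p2 : ((k + 2).choose (r + 2) : ℝ) = (k + 1).choose (r + 1) + (k + 1).choose (r + 2) := by
    exact_mod_cast Nat.choose_succ_succ (k + 1) (r + 1)
  have p3 : ((k + 3).choose (r + 2) : ℝ) = (k + 2).choose (r + 1) + (k + 2).choose (r + 2) := by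
    exact_mod_cast Nat.choose_succ_succ (k + 2) (r + 1)
  push_cast at e0 e1 e2 c1 c2
  set V : ℝ := ((k + 1).choose r : ℝ) with hV
  have d1 : ((k + 1).choose (r + 1) : ℝ) = (k + 1 - r) * V / (r + 1) := by
    rw [eq_div_iff hr1]; linarith
  have d2 : ((k + 1).choose (r + 2) : ℝ) = (k - r) * ((k + 1 - r) * V / (r + 1)) / (r + 2) := by
    rw [eq_div_iff hr2, ← d1]; linear_combination c2
  rw [mul_add ((k : ℝ) + 1), mul_sub, mul_left_comm, e0, e1, e2]
  have f1 : narayanaCoeff (k + 2) (r + 2) =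
      ((k + 3).choose (r + 2) : ℝ) * ((k + 2).choose (r + 2) : ℝ) / (r + 3) := by
    simp only [narayanaCoeff]; push_cast; rw [show (r : ℝ) + 2 + 1 = r + 3 by ring]; ring
  have f2 : narayanaCoeff (k + 1) (r + 2) =
      ((k + 2).choose (r + 2) : ℝ) * ((k + 1).choose (r + 2) : ℝ) / (r + 3) := by
    simp only [narayanaCoeff]; push_cast; rw [show (r : ℝ) + 2 + 1 = r + 3 by ring]; ring
  have f3 : narayanaCoeff (k + 1) (r + 1) =
      ((k + 2).choose (r + 1) : ℝ) * ((k + 1).choose (r + 1) : ℝ) / (r + 2) := by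
    simp only [narayanaCoeff]; push_cast; rw [show (r : ℝ) + 1 + 1 = r + 2 by ring]; ring
  rw [f1, f2, f3, p3, p1, p2, d2, d1, show (r : ℝ) + 2 + 1 = r + 3 by ring,
    show (r : ℝ) + 1 + 1 = r + 2 by ring]
  field_simp
  ring

open Polynomial in
/-- The Narayana polynomials. -/
noncomputable def narayanaPoly (k : ℕ) : Polynomial ℝ :=
  ∑ r ∈ Finset.range (k + 1), monomial r (narayanaCoeff k r)

theorem coeff_narayanaPoly (k r : ℕ) : (narayanaPoly k).coeff r = narayanaCoeff k r := by
  simp only [narayanaPoly, Polynomial.finsetSum_coeff, Polynomial.coeff_monomial]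
  rw [Finset.sum_ite_eq' (Finset.range (k + 1)) r]
  split_ifs with h
  · rfl
  · exact (narayanaCoeff_eq_zero (by simpa using h)).symm

open Polynomial in
theorem narayanaPoly_three_term (k : ℕ) :
    C ((k : ℝ) + 4) * narayanaPoly (k + 2) =
      C (2 * (k : ℝ) + 5) * (narayanaPoly (k + 1) + X * narayanaPoly (k + 1)) -
      C ((k : ℝ) + 1) * (narayanaPoly k - C 2 * (X * narayanaPoly k) +
        X * (X * narayanaPoly k)) := by
  ext m
  simp only [coeff_C_mul, coeff_sub, coeff_add]
  rcases m with _ | _ | m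
  · simp only [coeff_X_mul_zero, coeff_narayanaPoly, narayanaCoeff_zero]; ring
  · simp only [coeff_X_mul, zero_add, coeff_X_mul_zero, coeff_narayanaPoly, narayanaCoeff_zero,
      narayanaCoeff_one]
    push_cast; ring
  · simp only [coeff_X_mul, coeff_narayanaPoly]
    exact narayanaCoeff_three_term k m

/-- At `k = 0` the last coefficient vanishes, so the value at `1` determines everything after it and
the value at `0` is irrelevant. This matters because the zeroth terms of the sequences compared need
not agree. -/
theorem eq_of_three_term {c : ℝ} {f g : ℕ → ℝ}
    (hf : ∀ k : ℕ, ((k : ℝ) + 3) * f (k + 2) =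
      (2 * k + 3) * (1 + c) * f (k + 1) - k * (1 - c) ^ 2 * f k)
    (hg : ∀ k : ℕ, ((k : ℝ) + 3) * g (k + 2) =
      (2 * k + 3) * (1 + c) * g (k + 1) - k * (1 - c) ^ 2 * g k)
    (h1 : f 1 = g 1) (k : ℕ) : f (k + 1) = g (k + 1) := by
  have key : ∀ k : ℕ, f (k + 1) = g (k + 1) ∧ f (k + 2) = g (k + 2) := by
    intro k
    have step : ∀ j : ℕ, f (j + 1) = g (j + 1) → (j : ℝ) * f j = j * g j →
        f (j + 2) = g (j + 2) := by
      intro j h h'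
      have h3 : (j : ℝ) + 3 ≠ 0 := by positivity
      apply mul_left_cancel₀ h3
      rw [hf, hg, h]
      linear_combination (-(1 - c) ^ 2) * h'
    induction k with
    | zero => exact ⟨h1, step 0 h1 (by simp)⟩
    | succ k ih => exact ⟨ih.2, step (k + 1) ih.2 (by rw [ih.1])⟩
  exact (key k).1

theorem mpSeq_eq_narayana {c : ℝ} (hc : c ≠ 0) (k : ℕ) :
    mpSeq c (k + 1) = (narayanaPoly k).eval c := by
  refine eq_of_three_term (c := c) (g := fun k => (narayanaPoly (k - 1)).eval c)
    (mpSeq_three_term hc) ?_ ?_ k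
  · rintro (_ | k)
    · simp [narayanaPoly, Finset.sum_range_succ, narayanaCoeff_zero, narayanaCoeff_one]
    · have := congrArg (Polynomial.eval c) (narayanaPoly_three_term k)
      simp only [Polynomial.eval_mul, Polynomial.eval_C, Polynomial.eval_sub, Polynomial.eval_add,
        Polynomial.eval_X] at this
      simp only [Nat.add_sub_cancel, show k + 1 + 2 - 1 = k + 2 by omega]
      push_cast
      linear_combination this
  · simp [narayanaPoly, mpSeq_one, narayanaCoeff_zero]

/-! ### Marchenko–Pastur integrals -/

theorem mp_quadratic (c x : ℝ) (hc : 0 ≤ c) :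
    (mpRight c - x) * (x - mpLeft c) = -x ^ 2 + 2 * (1 + c) * x - (1 - c) ^ 2 := by
  have h : √c ^ 2 = c := Real.sq_sqrt hc
  simp only [mpLeft, mpRight]
  linear_combination (2 * x + 2 - √c ^ 2 - c) * h

theorem mpLeft_le_mpRight {c : ℝ} : mpLeft c ≤ mpRight c := by
  have := Real.sqrt_nonneg c
  simp only [mpLeft, mpRight]; nlinarith

/-- Unnormalized moments of the semicircle on `[mpLeft c, mpRight c]`. -/
noncomputable def semicircleMoment (c : ℝ) (j : ℕ) : ℝ :=
  ∫ x in (mpLeft c)..(mpRight c), x ^ j * √((mpRight c - x) * (x - mpLeft c))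

theorem mpMoment_succ {c : ℝ} (hc : 0 < c) (j : ℕ) :
    mpMoment (j + 1) c = semicircleMoment c j / (2 * Real.pi * c) := by
  rw [mpMoment, semicircleMoment, ← intervalIntegral.integral_div]
  refine intervalIntegral.integral_congr fun x hx => ?_
  rw [Set.uIcc_of_le mpLeft_le_mpRight] at hx
  simp only [mpDensity, if_pos hx]
  have hpi := Real.pi_pos
  -- The point `x = 0`, where `x` cannot be cancelled, is harmless: the radicand there is `-(1 - c)²
  -- ≤ 0`, so both sides vanish.
  by_cases h0 : x = 0
  · have : (mpRight c - x) * (x - mpLeft c) ≤ 0 := by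
      rw [mp_quadratic c x hc.le, h0]; nlinarith [sq_nonneg (1 - c)]
    simp [Real.sqrt_eq_zero_of_nonpos this]
  · field_simp
    ring

/-- With `q` the quadratic under the root, `x^(j+1) q^(3/2)` vanishes at both end points, so its
derivative integrates to zero; that derivative is a combination of three consecutive integrands. -/
theorem semicircleMoment_three_term {c : ℝ} (hc : 0 < c) (j : ℕ) :
    ((j : ℝ) + 4) * semicircleMoment c (j + 2) =
      (2 * j + 5) * (1 + c) * semicircleMoment c (j + 1) -
        (j + 1) * (1 - c) ^ 2 * semicircleMoment c j := by
  set q : ℝ → ℝ := fun x => (mpRight c - x) * (x - mpLeft c) with hq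
  have hqc : Continuous q := by fun_prop
  have hsc : Continuous fun x => √(q x) := hqc.sqrt
  have hint : ∀ m : ℕ, IntervalIntegrable (fun x => x ^ m * √(q x)) volume (mpLeft c) (mpRight c) :=
    fun m => ((continuous_pow m).mul hsc).intervalIntegrable _ _
  have hder : ∀ x ∈ Set.Ioo (mpLeft c) (mpRight c),
      HasDerivAt (fun x => x ^ (j + 1) * (q x * √(q x)))
        (-(j + 4) * (x ^ (j + 2) * √(q x)) + (2 * j + 5) * (1 + c) * (x ^ (j + 1) * √(q x))
          - (j + 1) * (1 - c) ^ 2 * (x ^ j * √(q x))) x := by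
    intro x hx
    have hpos : 0 < q x := mul_pos (by linarith [hx.2]) (by linarith [hx.1])
    have hq' : HasDerivAt q (-2 * x + 2 * (1 + c)) x := by
      have h1 : q = fun x => -x ^ 2 + 2 * (1 + c) * x - (1 - c) ^ 2 :=
        funext fun x => mp_quadratic c x hc.le
      rw [h1]
      have h2 := ((((hasDerivAt_id x).pow 2).neg).add
        ((hasDerivAt_id x).const_mul (2 * (1 + c)))).sub_const ((1 - c) ^ 2)
      convert! h2 using 1
      simp
    have hs' := hq'.sqrt hpos.ne'
    have h := ((hasDerivAt_pow (j + 1) x).mul (hq'.mul hs'))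
    refine h.congr_deriv ?_
    have hs : √(q x) ≠ 0 := (Real.sqrt_pos.2 hpos).ne'
    have hss : √(q x) * √(q x) = q x := Real.mul_self_sqrt hpos.le
    have hqx : q x = -x ^ 2 + 2 * (1 + c) * x - (1 - c) ^ 2 := mp_quadratic c x hc.le
    have e1 : q x * ((-2 * x + 2 * (1 + c)) / (2 * √(q x))) = (-x + (1 + c)) * √(q x) := by
      have key : ∀ Q s D : ℝ, s ≠ 0 → s * s = Q → Q * (D / (2 * s)) = D / 2 * s := by
        rintro _ s D h rfl; field_simp
      rw [key _ _ _ hs hss]; ring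
    simp only [Pi.mul_apply, e1]
    rw [show j + 1 - 1 = j by omega]
    push_cast
    linear_combination ((j : ℝ) + 1) * x ^ j * √(q x) * hqx
  have hcont : ContinuousOn (fun x => x ^ (j + 1) * (q x * √(q x)))
      (Set.Icc (mpLeft c) (mpRight c)) := by fun_prop
  have hftc := intervalIntegral.integral_eq_sub_of_hasDerivAt_of_le mpLeft_le_mpRight hcont hder
    (by
      exact ((((hint _).const_mul _).add ((hint _).const_mul _)).sub ((hint _).const_mul _)))
  rw [intervalIntegral.integral_sub (((hint _).const_mul _).add ((hint _).const_mul _))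
      ((hint _).const_mul _),
    intervalIntegral.integral_add ((hint _).const_mul _) ((hint _).const_mul _)] at hftc
  simp only [intervalIntegral.integral_const_mul] at hftc
  have hl : q (mpLeft c) = 0 := by simp [hq]
  have hr : q (mpRight c) = 0 := by simp [hq]
  rw [hl, hr] at hftc
  simp only [semicircleMoment]
  linear_combination -hftc

/-- The affine map of `[-1, 1]` onto the interval turns this into the area `π / 2` of a half disc.
-/
theorem semicircleMoment_zero {c : ℝ} (hc : 0 < c) :
    semicircleMoment c 0 = 2 * Real.pi * c := by
  have hs : √c ^ 2 = c := Real.sq_sqrt hc.le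
  have hsp : 0 < √c := Real.sqrt_pos.2 hc
  have h := intervalIntegral.integral_comp_mul_add (a := -1) (b := 1) (c := 2 * √c)
    (fun x => √((mpRight c - x) * (x - mpLeft c))) (by positivity) (1 + c)
  have hl : 2 * √c * (-1) + (1 + c) = mpLeft c := by
    simp only [mpLeft]; linear_combination -hs
  have hr : 2 * √c * 1 + (1 + c) = mpRight c := by
    simp only [mpRight]; linear_combination -hs
  rw [hl, hr] at h
  have h2 : ∀ x : ℝ, √((mpRight c - (2 * √c * x + (1 + c))) * (2 * √c * x + (1 + c) - mpLeft c)) =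
      2 * √c * √(1 - x ^ 2) := by
    intro x
    rw [mp_quadratic c _ hc.le]
    have : -(2 * √c * x + (1 + c)) ^ 2 + 2 * (1 + c) * (2 * √c * x + (1 + c)) - (1 - c) ^ 2 =
        (2 * √c) ^ 2 * (1 - x ^ 2) := by
      linear_combination (-4) * hs
    rw [this, Real.sqrt_mul (by positivity), Real.sqrt_sq (by positivity)]
  simp only [h2, intervalIntegral.integral_const_mul, integral_sqrt_one_sub_sq] at h
  simp only [semicircleMoment, pow_zero, one_mul]
  rw [smul_eq_mul, eq_inv_mul_iff_mul_eq₀ (by positivity)] at h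
  rw [← h]
  linear_combination (2 * Real.pi) * hs

theorem mpMoment_eq_mpSeq {c : ℝ} (hc : 0 < c) (k : ℕ) : mpMoment (k + 1) c = mpSeq c (k + 1) := by
  have hpi := Real.pi_pos
  refine eq_of_three_term (c := c) (f := fun k => mpMoment k c) ?_ (mpSeq_three_term hc.ne') ?_ k
  · rintro (_ | j)
    -- The integral recurrence starts one index later, so the second moment is found separately,
    -- from the symmetry of the semicircle about `1 + c`.
    · have h2 : mpMoment 2 c = 1 + c := by
        rw [mpMoment_succ hc]
        have hs : √c ^ 2 = c := Real.sq_sqrt hc.le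
        set q : ℝ → ℝ := fun x => (mpRight c - x) * (x - mpLeft c) with hq
        have hint : ∀ m : ℕ,
            IntervalIntegrable (fun x => x ^ m * √(q x)) volume (mpLeft c) (mpRight c) :=
          fun m => ((continuous_pow m).mul (by fun_prop)).intervalIntegrable _ _
        have hsym : semicircleMoment c 1 = 2 * (1 + c) * semicircleMoment c 0 -
            semicircleMoment c 1 := by
          have h := intervalIntegral.integral_comp_sub_left (a := mpLeft c) (b := mpRight c)
            (fun x => x ^ 1 * √(q x)) (2 * (1 + c))
          have hl : 2 * (1 + c) - mpRight c = mpLeft c := by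
            simp only [mpLeft, mpRight]; linear_combination -2 * hs
          have hr : 2 * (1 + c) - mpLeft c = mpRight c := by linarith
          rw [hl, hr] at h
          have hqq : ∀ x, q (2 * (1 + c) - x) = q x := by
            intro x; simp only [hq]; rw [← hl]; ring
          simp only [hqq, pow_one] at h
          have h3 : ∀ x : ℝ, (2 * (1 + c) - x) * √(q x) =
              2 * (1 + c) * (x ^ 0 * √(q x)) - x ^ 1 * √(q x) := by intro x; ring
          simp only [h3] at h
          rw [intervalIntegral.integral_sub ((hint 0).const_mul _) (hint 1),
            intervalIntegral.integral_const_mul] at h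
          simp only [semicircleMoment, pow_one] at h ⊢
          exact h.symm
        rw [semicircleMoment_zero hc] at hsym
        rw [div_eq_iff (by positivity)]
        linarith
      have h1 : mpMoment 1 c = 1 := by
        rw [mpMoment_succ hc, semicircleMoment_zero hc]; field_simp
      simp only [zero_add, h1, h2]; push_cast; ring
    · simp only [mpMoment_succ hc]
      have := semicircleMoment_three_term hc j
      push_cast
      field_simp
      linear_combination this
  · simp only [mpSeq_one]
    rw [mpMoment_succ hc, semicircleMoment_zero hc]; field_simp

theorem mpMoment_eq_sum {c : ℝ} (hc : 0 < c) {k : ℕ} (hk : 1 ≤ k) :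
    mpMoment k c = ∑ r ∈ Finset.range k,
      1 / ((r : ℝ) + 1) * (k.choose r : ℝ) * ((k - 1).choose r : ℝ) * c ^ r := by
  obtain ⟨k, rfl⟩ := Nat.exists_eq_add_of_le' hk
  rw [mpMoment_eq_mpSeq hc, mpSeq_eq_narayana hc.ne', narayanaPoly, Polynomial.eval_finsetSum]
  simp [narayanaCoeff]

/-! ### Moment functionals, integration by parts and decoupling -/

section Functional

open MvPolynomial

variable {σ : Type*}

/-- The additive functional on polynomials with natural coefficients that takes the value `w s` at
the monomial with exponent `s`. -/
noncomputable def monomialFunctional (w : (σ →₀ ℕ) → ℝ) : MvPolynomial σ ℕ →ₗ[ℕ] ℝ :=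
  (basisMonomials σ ℕ).constr ℕ w

theorem monomialFunctional_monomial_one (w : (σ →₀ ℕ) → ℝ) (s : σ →₀ ℕ) :
    monomialFunctional w (monomial s 1) = w s := by
  have := (basisMonomials σ ℕ).constr_basis ℕ w s
  rwa [coe_basisMonomials] at this

theorem monomialFunctional_monomial (w : (σ →₀ ℕ) → ℝ) (s : σ →₀ ℕ) (a : ℕ) :
    monomialFunctional w (monomial s a) = a * w s := by
  have : monomial s a = a • (monomial s 1 : MvPolynomial σ ℕ) := by
    rw [smul_monomial, smul_eq_mul, mul_one]
  rw [this, map_smul, monomialFunctional_monomial_one, nsmul_eq_mul]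

/-- Natural coefficients make every polynomial a sum of monic monomials. Additive inequalities
therefore pass from monomials to all polynomials, without any sign condition to track. -/
theorem MvPolynomial.induction_on_nat {motive : MvPolynomial σ ℕ → Prop} (f : MvPolynomial σ ℕ)
    (zero : motive 0) (mono : ∀ s, motive (monomial s 1))
    (add : ∀ f g, motive f → motive g → motive (f + g)) : motive f := by
  refine MvPolynomial.induction_on' f (fun s a => ?_) add
  induction a with
  | zero => simpa using zero
  | succ a ih => rw [map_add]; exact add _ _ ih (mono s)

theorem monomialFunctional_nonneg {w : (σ →₀ ℕ) → ℝ} (hw : ∀ s, 0 ≤ w s) (f : MvPolynomial σ ℕ) :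
    0 ≤ monomialFunctional w f := by
  induction f using MvPolynomial.induction_on_nat with
  | zero => simp
  | mono s => rw [monomialFunctional_monomial_one]; exact hw s
  | add f g hf hg => rw [map_add]; exact add_nonneg hf hg

theorem monomialFunctional_mono {w w' : (σ →₀ ℕ) → ℝ} (hw : ∀ s, w s ≤ w' s)
    (f : MvPolynomial σ ℕ) : monomialFunctional w f ≤ monomialFunctional w' f := by
  induction f using MvPolynomial.induction_on_nat with
  | zero => simp
  | mono s => simp only [monomialFunctional_monomial_one]; exact hw s
  | add f g hf hg => simp only [map_add]; exact add_le_add hf hg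

theorem monomialFunctional_const_mul (w : (σ →₀ ℕ) → ℝ) (C : ℝ)
    (f : MvPolynomial σ ℕ) :
    monomialFunctional (fun s => C * w s) f = C * monomialFunctional w f := by
  induction f using MvPolynomial.induction_on_nat with
  | zero => simp
  | mono s => simp only [monomialFunctional_monomial_one]
  | add f g hf hg => simp only [map_add, hf, hg, mul_add]

theorem monomialFunctional_pderiv (w : (σ →₀ ℕ) → ℝ) (e : σ) (s : σ →₀ ℕ) :
    monomialFunctional w (pderiv e (monomial s 1)) = s e * w (s - Finsupp.single e 1) := by
  rw [pderiv_monomial, one_mul, monomialFunctional_monomial]; simp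

theorem monomialFunctional_X_mul_pderiv (w : (σ →₀ ℕ) → ℝ) (e : σ) (s : σ →₀ ℕ) :
    monomialFunctional w (X e * pderiv e (monomial s 1)) = s e * w s := by
  rw [X_mul_pderiv_monomial, map_nsmul, monomialFunctional_monomial_one, nsmul_eq_mul]

theorem monomialFunctional_pderiv_mul_pderiv (w : (σ →₀ ℕ) → ℝ) (e : σ) (s t : σ →₀ ℕ) :
    monomialFunctional w (pderiv e (monomial s 1) * pderiv e (monomial t 1)) =
      s e * t e * w (s - Finsupp.single e 1 + (t - Finsupp.single e 1) : σ →₀ ℕ) := by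
  rw [pderiv_monomial, pderiv_monomial, monomial_mul, monomialFunctional_monomial]
  push_cast; ring

/-- Moments dominating those of a subgaussian law of unit variance, with constant `C`. -/
noncomputable def domMoment (C : ℝ) : ℕ → ℝ
  | 0 => 1
  | 1 => 0
  | k + 2 => (k + 1) * (if k = 0 then 1 else C) * domMoment C k

theorem domMoment_nonneg {C : ℝ} (hC : 0 ≤ C) (k : ℕ) : 0 ≤ domMoment C k := by
  induction k using Nat.twoStepInduction with
  | zero => simp [domMoment]
  | one => simp [domMoment]
  | more k ih _ =>
    rw [domMoment]
    have : (0 : ℝ) ≤ if k = 0 then 1 else C := by split_ifs <;> simp [hC]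
    positivity

theorem domMoment_odd (C : ℝ) (k : ℕ) : domMoment C (2 * k + 1) = 0 := by
  induction k with
  | zero => simp [domMoment]
  | succ k ih => rw [show 2 * (k + 1) + 1 = 2 * k + 1 + 2 by ring, domMoment, ih, mul_zero]

theorem domMoment_mul_le {C : ℝ} (hC : 1 ≤ C) (k l : ℕ) :
    domMoment C k * domMoment C l ≤ domMoment C (k + l) := by
  have hC0 : 0 ≤ C := by linarith
  induction l using Nat.twoStepInduction with
  | zero => simp [domMoment]
  | one => simpa [domMoment] using domMoment_nonneg hC0 (k + 1)
  | more l ih _ =>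
    rw [← add_assoc, domMoment, domMoment]
    have h0 := domMoment_nonneg hC0 (k + l)
    have h1 : (if l = 0 then 1 else C) ≤ if k + l = 0 then 1 else C := by
      split_ifs <;> first | omega | exact hC | exact le_rfl
    have h2 : (0 : ℝ) ≤ if l = 0 then 1 else C := by split_ifs <;> simp [hC0]
    calc domMoment C k * ((l + 1) * (if l = 0 then 1 else C) * domMoment C l)
        = ((l + 1) * (if l = 0 then 1 else C)) * (domMoment C k * domMoment C l) := by ring
      _ ≤ ((l + 1) * (if l = 0 then 1 else C)) * domMoment C (k + l) := by gcongr
      _ ≤ ((((k + l : ℕ) : ℝ) + 1) * (if k + l = 0 then 1 else C)) * domMoment C (k + l) := by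
        gcongr; linarith

/-- Removing one factor from each side costs at most `C (k+1) (l+1)`, because `k + l + 1 ≤
(k+1)(l+1)`. The factors `k+1` and `l+1` are those produced by derivatives. -/
theorem domMoment_add_le {C : ℝ} (hC : 1 ≤ C) (k l : ℕ) :
    domMoment C (k + 1 + (l + 1)) ≤ C * (k + 1) * (l + 1) * domMoment C (k + l) := by
  have h0 := domMoment_nonneg (by linarith : 0 ≤ C) (k + l)
  have h1 : (if k + l = 0 then 1 else C) ≤ C := by split_ifs <;> simp [hC]
  rw [show k + 1 + (l + 1) = k + l + 2 by ring, domMoment]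
  refine mul_le_mul_of_nonneg_right ?_ h0
  calc (((k + l : ℕ) : ℝ) + 1) * (if k + l = 0 then 1 else C)
      ≤ (((k + l : ℕ) : ℝ) + 1) * C := by gcongr
    _ ≤ C * (k + 1) * (l + 1) := by
      push_cast
      have : (0 : ℝ) ≤ C * (k * l) := by positivity
      linarith

variable [Fintype σ]

/-- The moment functional of independent variables with moment sequence `μ`. -/
noncomputable def momentFunctional (μ : ℕ → ℝ) : MvPolynomial σ ℕ →ₗ[ℕ] ℝ :=
  monomialFunctional fun s => ∏ e, μ (s e)

theorem momentFunctional_nonneg {μ : ℕ → ℝ} (hμ : ∀ k, 0 ≤ μ k) (f : MvPolynomial σ ℕ) :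
    0 ≤ momentFunctional μ f :=
  monomialFunctional_nonneg (fun _ => Finset.prod_nonneg fun _ _ => hμ _) f

theorem momentFunctional_one {μ : ℕ → ℝ} (h : μ 0 = 1) :
    momentFunctional μ (1 : MvPolynomial σ ℕ) = 1 := by
  have := monomialFunctional_monomial_one (fun s : σ →₀ ℕ => ∏ e, μ (s e)) 0
  rw [momentFunctional]
  simpa [h] using this

theorem momentFunctional_rename {τ : Type*} [Fintype τ] (μ : ℕ → ℝ) (φ : σ ≃ τ)
    (f : MvPolynomial σ ℕ) : momentFunctional μ (rename φ f) = momentFunctional μ f := by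
  induction f using MvPolynomial.induction_on_nat with
  | zero => simp
  | mono s =>
    simp only [momentFunctional, rename_monomial, monomialFunctional_monomial_one]
    rw [← Equiv.prod_comp φ]
    exact Finset.prod_congr rfl fun e _ => by
      rw [Finsupp.mapDomain_apply φ.injective]
  | add f g hf hg => simp only [map_add, hf, hg]

/-- Euler's identity for homogeneous polynomials; positivity allows the sum to be restricted to `S`.
-/
theorem sum_momentFunctional_X_mul_pderiv_le {μ : ℕ → ℝ} (hμ : ∀ k, 0 ≤ μ k)
    {f : MvPolynomial σ ℕ} {d : ℕ} (hf : f.IsHomogeneous d) (S : Finset σ) :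
    ∑ e ∈ S, momentFunctional μ (X e * pderiv e f) ≤ d * momentFunctional μ f := by
  calc ∑ e ∈ S, momentFunctional μ (X e * pderiv e f)
      ≤ ∑ e, momentFunctional μ (X e * pderiv e f) :=
        Finset.sum_le_sum_of_subset_of_nonneg (Finset.subset_univ S)
          fun _ _ _ => momentFunctional_nonneg hμ _
    _ = d * momentFunctional μ f := by
      rw [← map_sum, hf.sum_X_mul_pderiv, map_nsmul, nsmul_eq_mul]

/-- The moment functional with the monomials that contain the variable `e` multiplied by `C`. -/
noncomputable def tiltedFunctional (μ : ℕ → ℝ) (C : ℝ) (e : σ) : MvPolynomial σ ℕ →ₗ[ℕ] ℝ :=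
  monomialFunctional fun s => (if s e = 0 then 1 else C) * ∏ e', μ (s e')

theorem tiltedFunctional_le {μ : ℕ → ℝ} (hμ : ∀ k, 0 ≤ μ k) {C : ℝ} (hC : 1 ≤ C) (e : σ)
    (f : MvPolynomial σ ℕ) : tiltedFunctional μ C e f ≤ C * momentFunctional μ f := by
  rw [momentFunctional, ← monomialFunctional_const_mul]
  refine monomialFunctional_mono (fun s => ?_) f
  refine mul_le_mul_of_nonneg_right ?_ (Finset.prod_nonneg fun _ _ => hμ _)
  split_ifs <;> simp [hC]

theorem tiltedFunctional_nonneg {μ : ℕ → ℝ} (hμ : ∀ k, 0 ≤ μ k) {C : ℝ} (hC : 0 ≤ C) (e : σ)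
    (f : MvPolynomial σ ℕ) : 0 ≤ tiltedFunctional μ C e f := by
  refine monomialFunctional_nonneg (fun s => ?_) f
  refine mul_nonneg ?_ (Finset.prod_nonneg fun _ _ => hμ _)
  split_ifs <;> simp [hC]

/-- Integration by parts. The recursion defining `domMoment` is designed for it: the factor `k + 1`
is the derivative's, and the weight `1` or `C` is the tilt, according to whether the variable
survives differentiation. -/
theorem momentFunctional_X_mul (C : ℝ) (e : σ) (f : MvPolynomial σ ℕ) :
    momentFunctional (domMoment C) (X e * f) =
      tiltedFunctional (domMoment C) C e (pderiv e f) := by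
  classical
  induction f using MvPolynomial.induction_on_nat with
  | zero => simp
  | add f g hf hg => simp only [map_add, mul_add, hf, hg]
  | mono s =>
    rw [tiltedFunctional, monomialFunctional_pderiv, X, monomial_mul, one_mul, momentFunctional,
      monomialFunctional_monomial_one,
      ← Finset.mul_prod_erase Finset.univ
        (fun e' => domMoment C ((Finsupp.single e 1 + s : σ →₀ ℕ) e')) (Finset.mem_univ e),
      ← Finset.mul_prod_erase Finset.univ (fun e' => domMoment C ((s - Finsupp.single e 1 : σ →₀ ℕ) e'))
        (Finset.mem_univ e)]
    have hR : ∀ e' ∈ Finset.univ.erase e, domMoment C ((Finsupp.single e 1 + s : σ →₀ ℕ) e') =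
        domMoment C ((s - Finsupp.single e 1 : σ →₀ ℕ) e') := by
      intro e' he'
      have hne : e ≠ e' := (Finset.ne_of_mem_erase he').symm
      simp [hne]
    rw [Finset.prod_congr rfl hR]
    simp only [Finsupp.add_apply, Finsupp.single_eq_same, Finsupp.tsub_apply]
    rcases s e with _ | k
    · simp [domMoment]
    · rw [show 1 + (k + 1) = k + 2 by ring, domMoment, Nat.add_sub_cancel]
      push_cast; ring

/-- The lower counterpart of integration by parts. The tilt `0` keeps only monomials in which `e` no
longer occurs; there `μ 2 = μ 0 = 1` gives equality, and the discarded terms are nonnegative. -/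
theorem tiltedFunctional_zero_le {μ : ℕ → ℝ} (hμ : ∀ k, 0 ≤ μ k) (h0 : μ 0 = 1) (h2 : μ 2 = 1)
    (e : σ) (f : MvPolynomial σ ℕ) :
    tiltedFunctional μ 0 e (pderiv e f) ≤ momentFunctional μ (X e * f) := by
  classical
  induction f using MvPolynomial.induction_on_nat with
  | zero => simp
  | add f g hf hg => simp only [map_add, mul_add]; exact add_le_add hf hg
  | mono s =>
    rw [tiltedFunctional, monomialFunctional_pderiv, X, monomial_mul, one_mul, momentFunctional,
      monomialFunctional_monomial_one,
      ← Finset.mul_prod_erase Finset.univ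
        (fun e' => μ ((Finsupp.single e 1 + s : σ →₀ ℕ) e')) (Finset.mem_univ e),
      ← Finset.mul_prod_erase Finset.univ (fun e' => μ ((s - Finsupp.single e 1 : σ →₀ ℕ) e'))
        (Finset.mem_univ e)]
    have hR : ∀ e' ∈ Finset.univ.erase e, μ ((Finsupp.single e 1 + s : σ →₀ ℕ) e') =
        μ ((s - Finsupp.single e 1 : σ →₀ ℕ) e') := by
      intro e' he'
      have hne : e ≠ e' := (Finset.ne_of_mem_erase he').symm
      simp [hne]
    rw [Finset.prod_congr rfl hR]
    have hR0 : 0 ≤ ∏ x ∈ Finset.univ.erase e, μ ((s - Finsupp.single e 1 : σ →₀ ℕ) x) :=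
      Finset.prod_nonneg fun _ _ => hμ _
    simp only [Finsupp.add_apply, Finsupp.single_eq_same, Finsupp.tsub_apply]
    rcases s e with _ | _ | k
    · simpa using mul_nonneg (hμ _) hR0
    · simp [h0, h2]
    · simpa using mul_nonneg (hμ _) hR0

theorem prod_domMoment_add_le {C : ℝ} (hC : 1 ≤ C) (s t : σ →₀ ℕ) {e : σ} (hs : s e ≠ 0)
    (ht : t e ≠ 0) :
    ∏ e', domMoment C ((s + t) e') ≤ C * (s e * t e *
      ∏ e', domMoment C ((s - Finsupp.single e 1 + (t - Finsupp.single e 1) : σ →₀ ℕ) e')) := by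
  classical
  rw [← Finset.mul_prod_erase _ _ (Finset.mem_univ e),
    ← Finset.mul_prod_erase Finset.univ
      (fun e' => domMoment C ((s - Finsupp.single e 1 + (t - Finsupp.single e 1) : σ →₀ ℕ) e'))
      (Finset.mem_univ e)]
  have hR : ∀ e' ∈ Finset.univ.erase e, domMoment C ((s + t) e') =
      domMoment C ((s - Finsupp.single e 1 + (t - Finsupp.single e 1) : σ →₀ ℕ) e') := by
    intro e' he'
    have hne : e ≠ e' := (Finset.ne_of_mem_erase he').symm
    simp [hne]
  rw [Finset.prod_congr rfl hR]
  have hR0 : 0 ≤ ∏ x ∈ Finset.univ.erase e,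
      domMoment C ((s - Finsupp.single e 1 + (t - Finsupp.single e 1) : σ →₀ ℕ) x) :=
    Finset.prod_nonneg fun _ _ => domMoment_nonneg (by linarith) _
  simp only [Finsupp.add_apply, Finsupp.single_eq_same, Finsupp.tsub_apply] at hR0 ⊢
  obtain ⟨k, hk⟩ := Nat.exists_eq_succ_of_ne_zero hs
  obtain ⟨l, hl⟩ := Nat.exists_eq_succ_of_ne_zero ht
  rw [hk, hl]
  have := mul_le_mul_of_nonneg_right (domMoment_add_le hC k l) hR0
  simp only [Nat.succ_eq_add_one, Nat.add_sub_cancel]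
  push_cast
  linarith

theorem prod_add_of_disjoint {μ : ℕ → ℝ} (h0 : μ 0 = 1) (s t : σ →₀ ℕ)
    (h : ∀ e, s e = 0 ∨ t e = 0) :
    ∏ e, μ ((s + t) e) = (∏ e, μ (s e)) * ∏ e, μ (t e) := by
  rw [← Finset.prod_mul_distrib]
  refine Finset.prod_congr rfl fun e _ => ?_
  rcases h e with h | h <;> simp [h, h0]

/-- The error terms in the comparison of `E[f g]` with `E[f] E[g]`. -/
noncomputable def covarianceBound (C : ℝ) (e : σ) (f g : MvPolynomial σ ℕ) : ℝ :=
  C * (momentFunctional (domMoment C) (X e * pderiv e f) * momentFunctional (domMoment C) g +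
    momentFunctional (domMoment C) f * momentFunctional (domMoment C) (X e * pderiv e g)) +
  C ^ 2 * ∑ e', momentFunctional (domMoment C) (pderiv e' f * pderiv e' g)

theorem covarianceBound_add_left (C : ℝ) (e : σ) (f f' g : MvPolynomial σ ℕ) :
    covarianceBound C e (f + f') g = covarianceBound C e f g + covarianceBound C e f' g := by
  simp only [covarianceBound, map_add, mul_add, add_mul, Finset.sum_add_distrib]; ring

theorem covarianceBound_add_right (C : ℝ) (e : σ) (f g g' : MvPolynomial σ ℕ) :
    covarianceBound C e f (g + g') = covarianceBound C e f g + covarianceBound C e f g' := by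
  simp only [covarianceBound, map_add, mul_add, Finset.sum_add_distrib]; ring

theorem covarianceBound_monomial (C : ℝ) (e : σ) (s t : σ →₀ ℕ) :
    covarianceBound C e (monomial s 1) (monomial t 1) =
      C * ((s e + t e) * ((∏ e', domMoment C (s e')) * ∏ e', domMoment C (t e'))) +
      C ^ 2 * ∑ e', (s e' : ℝ) * t e' *
        ∏ e'', domMoment C ((s - Finsupp.single e' 1 + (t - Finsupp.single e' 1) : σ →₀ ℕ) e'') := by
  simp only [covarianceBound, momentFunctional, monomialFunctional_X_mul_pderiv,
    monomialFunctional_pderiv_mul_pderiv, monomialFunctional_monomial_one]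
  ring

/-- The derivative term at the shared variable `e₀` alone suffices: one factor `C` pays for
`prod_domMoment_add_le`, the other for a possible tilt. -/
theorem le_covarianceBound_of_shared {C : ℝ} (hC : 1 ≤ C) (e : σ) (s t : σ →₀ ℕ) {e₀ : σ}
    (hs : s e₀ ≠ 0) (ht : t e₀ ≠ 0) :
    C * ∏ e', domMoment C ((s + t) e') ≤ covarianceBound C e (monomial s 1) (monomial t 1) := by
  have hC0 : 0 ≤ C := by linarith
  have hP : ∀ u : σ →₀ ℕ, 0 ≤ ∏ e', domMoment C (u e') :=
    fun u => Finset.prod_nonneg fun _ _ => domMoment_nonneg hC0 _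
  rw [covarianceBound_monomial]
  have h1 := mul_le_mul_of_nonneg_left (prod_domMoment_add_le hC s t hs ht) hC0
  have h2 := Finset.single_le_sum (f := fun e' => (s e' : ℝ) * t e' *
        ∏ e'', domMoment C ((s - Finsupp.single e' 1 + (t - Finsupp.single e' 1) : σ →₀ ℕ) e''))
        (fun e' _ => mul_nonneg (by positivity) (hP _)) (Finset.mem_univ e₀)
  have h3 : 0 ≤ C * (((s e : ℝ) + t e) *
      ((∏ e', domMoment C (s e')) * ∏ e', domMoment C (t e'))) :=
    mul_nonneg hC0 (mul_nonneg (by positivity) (mul_nonneg (hP _) (hP _)))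
  have h4 := mul_le_mul_of_nonneg_left h2 (sq_nonneg C)
  linarith

/-- On monomials without a common variable the functional factorises, and only the tilt must be
paid, at most `1 + C (s e + t e)`, which the terms with `X e * pderiv e` record. Monomials with a
common variable are charged entirely to the error. -/
theorem tiltedFunctional_mul_le {C : ℝ} (hC : 1 ≤ C) (e : σ) (f g : MvPolynomial σ ℕ) :
    tiltedFunctional (domMoment C) C e (f * g) ≤
      momentFunctional (domMoment C) f * momentFunctional (domMoment C) g +
        covarianceBound C e f g := by
  have hC0 : 0 ≤ C := by linarith
  induction f using MvPolynomial.induction_on_nat with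
  | zero => simp [covarianceBound]
  | add f f' hf hf' =>
    simp only [add_mul, map_add, covarianceBound_add_left]; linarith
  | mono s =>
    induction g using MvPolynomial.induction_on_nat with
    | zero => simp [covarianceBound]
    | add g g' hg hg' =>
      simp only [mul_add, map_add, covarianceBound_add_right]; linarith
    | mono t =>
      have hP : ∀ u : σ →₀ ℕ, 0 ≤ ∏ e', domMoment C (u e') :=
        fun u => Finset.prod_nonneg fun _ _ => domMoment_nonneg hC0 _
      rw [monomial_mul, one_mul, tiltedFunctional, momentFunctional]
      simp only [monomialFunctional_monomial_one]
      by_cases hsh : ∃ e₀, s e₀ ≠ 0 ∧ t e₀ ≠ 0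
      · obtain ⟨e₀, hs, ht⟩ := hsh
        have h1 := le_covarianceBound_of_shared hC e s t hs ht
        have h2 : (if (s + t) e = 0 then 1 else C) ≤ C := by split_ifs <;> simp [hC]
        have h3 := mul_le_mul_of_nonneg_right h2 (hP (s + t))
        have h4 := mul_nonneg (hP s) (hP t)
        linarith
      · have hsh' : ∀ e', s e' = 0 ∨ t e' = 0 := by
          intro e'; by_contra h; exact hsh ⟨e', by tauto⟩
        rw [prod_add_of_disjoint (by simp [domMoment]) s t hsh', covarianceBound_monomial]
        have h5 : 0 ≤ C ^ 2 * ∑ e', (s e' : ℝ) * t e' * ∏ e'',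
            domMoment C ((s - Finsupp.single e' 1 + (t - Finsupp.single e' 1) : σ →₀ ℕ) e'') :=
          mul_nonneg (sq_nonneg C) (Finset.sum_nonneg fun e' _ =>
            mul_nonneg (by positivity) (hP _))
        have h4 := mul_nonneg (hP s) (hP t)
        have h6 : (if (s + t) e = 0 then 1 else C) ≤ 1 + C * ((s e : ℝ) + t e) := by
          split_ifs with h
          · have : 0 ≤ C * ((s e : ℝ) + t e) := by positivity
            linarith
          · have : (1 : ℝ) ≤ (s e : ℝ) + t e := by
              rw [Finsupp.add_apply] at h; exact_mod_cast Nat.one_le_iff_ne_zero.2 h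
            nlinarith
        have h7 := mul_le_mul_of_nonneg_right h6 h4
        linarith

/-- The same dichotomy from below. A disjoint pair avoiding `e` gives equality of the main terms;
every other pair is absorbed in the error, using `domMoment_mul_le` when a variable is shared. -/
theorem momentFunctional_mul_le {C : ℝ} (hC : 1 ≤ C) {μ : ℕ → ℝ} (hμ : ∀ k, 0 ≤ μ k)
    (h0 : μ 0 = 1) (hle : ∀ k, μ k ≤ domMoment C k) (e : σ) (f g : MvPolynomial σ ℕ) :
    momentFunctional μ f * momentFunctional μ g ≤
      tiltedFunctional μ 0 e (f * g) + covarianceBound C e f g := by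
  have hC0 : 0 ≤ C := by linarith
  induction f using MvPolynomial.induction_on_nat with
  | zero => simp [covarianceBound]
  | add f f' hf hf' =>
    simp only [add_mul, map_add, covarianceBound_add_left]; linarith
  | mono s =>
    induction g using MvPolynomial.induction_on_nat with
    | zero => simp [covarianceBound]
    | add g g' hg hg' =>
      simp only [mul_add, map_add, covarianceBound_add_right]; linarith
    | mono t =>
      have hP : ∀ u : σ →₀ ℕ, 0 ≤ ∏ e', domMoment C (u e') :=
        fun u => Finset.prod_nonneg fun _ _ => domMoment_nonneg hC0 _
      have hQ : ∀ u : σ →₀ ℕ, 0 ≤ ∏ e', μ (u e') :=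
        fun u => Finset.prod_nonneg fun _ _ => hμ _
      have hQP : ∀ u : σ →₀ ℕ, ∏ e', μ (u e') ≤ ∏ e', domMoment C (u e') :=
        fun u => Finset.prod_le_prod (fun _ _ => hμ _) fun _ _ => hle _
      have hQQ := mul_le_mul (hQP s) (hQP t) (hQ t) (hP s)
      rw [monomial_mul, one_mul, tiltedFunctional, momentFunctional]
      simp only [monomialFunctional_monomial_one]
      by_cases hsh : ∃ e₀, s e₀ ≠ 0 ∧ t e₀ ≠ 0
      · obtain ⟨e₀, hs, ht⟩ := hsh
        have h1 := le_covarianceBound_of_shared hC e s t hs ht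
        have h2 : (∏ e', domMoment C (s e')) * ∏ e', domMoment C (t e') ≤
            ∏ e', domMoment C ((s + t) e') := by
          rw [← Finset.prod_mul_distrib]
          exact Finset.prod_le_prod (fun _ _ => mul_nonneg (domMoment_nonneg hC0 _)
            (domMoment_nonneg hC0 _)) fun e' _ => domMoment_mul_le hC _ _
        have h3 := le_mul_of_one_le_left (hP (s + t)) hC
        have h4 : (0 : ℝ) ≤ if (s + t) e = 0 then 1 else 0 := by split_ifs <;> simp
        have h5 := mul_nonneg h4 (hQ (s + t))
        linarith
      · have hsh' : ∀ e', s e' = 0 ∨ t e' = 0 := by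
          intro e'; by_contra h; exact hsh ⟨e', by tauto⟩
        rw [prod_add_of_disjoint h0 s t hsh', covarianceBound_monomial]
        have h5 : 0 ≤ C ^ 2 * ∑ e', (s e' : ℝ) * t e' * ∏ e'',
            domMoment C ((s - Finsupp.single e' 1 + (t - Finsupp.single e' 1) : σ →₀ ℕ) e'') :=
          mul_nonneg (sq_nonneg C) (Finset.sum_nonneg fun e' _ =>
            mul_nonneg (by positivity) (hP _))
        have h4 := mul_nonneg (hP s) (hP t)
        split_ifs with h
        · have : 0 ≤ C * (((s e : ℝ) + t e) *
            ((∏ e', domMoment C (s e')) * ∏ e', domMoment C (t e'))) := by positivity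
          linarith
        · have h6 : (1 : ℝ) ≤ (s e : ℝ) + t e := by
            rw [Finsupp.add_apply] at h; exact_mod_cast Nat.one_le_iff_ne_zero.2 h
          have h7 := le_mul_of_one_le_left h4 (one_le_mul_of_one_le_of_one_le hC h6)
          rw [mul_assoc] at h7
          linarith

end Functional

/-! ### Gram matrices of indeterminates and their derivatives -/

section Gram

set_option linter.unusedSectionVars false

open MvPolynomial

variable (ι κ : Type*)

/-- The matrix of indeterminates. -/
noncomputable def varMatrix : Matrix ι κ (MvPolynomial (ι × κ) ℕ) :=
  Matrix.of fun i j => X (i, j)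

/-- The product `X Xᵀ` of the matrix of indeterminates with its transpose. -/
noncomputable def rowGram [Fintype κ] : Matrix ι ι (MvPolynomial (ι × κ) ℕ) :=
  varMatrix ι κ * (varMatrix ι κ)ᵀ

/-- The product `Xᵀ X` of the matrix of indeterminates with its transpose. -/
noncomputable def colGram [Fintype ι] : Matrix κ κ (MvPolynomial (ι × κ) ℕ) :=
  (varMatrix ι κ)ᵀ * varMatrix ι κ

variable {ι κ}

theorem varMatrix_apply (i : ι) (j : κ) : varMatrix ι κ i j = X (i, j) := rfl

theorem map_pderiv_mul {l m n σ : Type*} [Fintype m] (e : σ)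
    (M : Matrix l m (MvPolynomial σ ℕ)) (L : Matrix m n (MvPolynomial σ ℕ)) :
    (M * L).map (pderiv e) = M.map (pderiv e) * L + M * L.map (pderiv e) := by
  ext i j : 2
  simp only [Matrix.map_apply, Matrix.mul_apply, map_sum, Matrix.add_apply, pderiv_mul,
    Finset.sum_add_distrib]

theorem map_pderiv_varMatrix [DecidableEq ι] [DecidableEq κ] (i : ι) (j : κ) :
    (varMatrix ι κ).map (pderiv (i, j)) = Matrix.single i j 1 := by
  ext i' j' : 2
  simp only [Matrix.map_apply, varMatrix_apply, pderiv_X, Pi.single_apply, Matrix.single_apply,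
    Prod.mk.injEq, eq_comm]

theorem mul_single_mul_apply {l m n o R : Type*} [Fintype m] [Fintype n] [DecidableEq m]
    [DecidableEq n] [CommSemiring R] (M : Matrix l m R) (i : m) (j : n) (L : Matrix n o R) (a : l)
    (b : o) : (M * Matrix.single i j (1 : R) * L) a b = M a i * L j b := by
  rw [Matrix.mul_apply, Finset.sum_eq_single j]
  · simp
  · intro j' _ h; simp [h]
  · simp

variable [Fintype ι] [Fintype κ] [DecidableEq ι] [DecidableEq κ]

theorem transpose_rowGram_pow (b : ℕ) : (rowGram ι κ ^ b)ᵀ = rowGram ι κ ^ b := by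
  rw [Matrix.transpose_pow, rowGram, Matrix.transpose_mul, Matrix.transpose_transpose]

theorem transpose_varMatrix_mul_rowGram_pow (b : ℕ) :
    (varMatrix ι κ)ᵀ * rowGram ι κ ^ b = colGram ι κ ^ b * (varMatrix ι κ)ᵀ := by
  induction b with
  | zero => simp
  | succ b ih =>
    rw [pow_succ, ← Matrix.mul_assoc, ih, pow_succ, rowGram, colGram]
    simp only [Matrix.mul_assoc]

theorem colGram_pow_succ (b : ℕ) :
    colGram ι κ ^ (b + 1) = (varMatrix ι κ)ᵀ * rowGram ι κ ^ b * varMatrix ι κ := by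
  rw [transpose_varMatrix_mul_rowGram_pow, pow_succ, colGram, Matrix.mul_assoc]

theorem trace_colGram_pow_succ (b : ℕ) :
    (colGram ι κ ^ (b + 1)).trace = (rowGram ι κ ^ (b + 1)).trace := by
  rw [colGram_pow_succ, Matrix.trace_mul_comm, ← Matrix.mul_assoc, pow_succ', rowGram]

theorem map_pderiv_pow {σ : Type*} (e : σ) (M : Matrix ι ι (MvPolynomial σ ℕ)) (q : ℕ) :
    (M ^ q).map (pderiv e) =
      ∑ c ∈ Finset.range q, M ^ c * M.map (pderiv e) * M ^ (q - 1 - c) := by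
  induction q with
  | zero =>
    ext i j : 2
    simp only [pow_zero, Matrix.map_apply, Finset.range_zero, Finset.sum_empty, Matrix.zero_apply,
      Matrix.one_apply]
    split_ifs <;> simp
  | succ q ih =>
    rw [pow_succ, map_pderiv_mul, ih, Finset.sum_mul, Finset.sum_range_succ]
    refine congrArg₂ (· + ·) (Finset.sum_congr rfl fun c hc => ?_) ?_
    · rw [Matrix.mul_assoc, ← pow_succ,
        show q - 1 - c + 1 = q + 1 - 1 - c by have := Finset.mem_range.1 hc; omega]
    · rw [show q + 1 - 1 - q = 0 by omega, pow_zero, Matrix.mul_one]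

theorem map_pderiv_rowGram (i : ι) (j : κ) :
    (rowGram ι κ).map (pderiv (i, j)) =
      Matrix.single i j (1 : MvPolynomial (ι × κ) ℕ) * (varMatrix ι κ)ᵀ +
        varMatrix ι κ * Matrix.single j i (1 : MvPolynomial (ι × κ) ℕ) := by
  rw [rowGram, map_pderiv_mul, map_pderiv_varMatrix, Matrix.transpose_map, map_pderiv_varMatrix,
    Matrix.transpose_single]

/-- Differentiating the leading `Xᵀ` or a later `Xᵀ` splits the word into two closed words, which
gives the first sum. Differentiating an `X` gives two open words from `j` to `i`, whose total over
`i` and `j` is only a single trace. -/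
theorem pderiv_transpose_varMatrix_mul_pow (q : ℕ) (i : ι) (j : κ) :
    pderiv (i, j) (((varMatrix ι κ)ᵀ * rowGram ι κ ^ q) j i) =
      ∑ a ∈ Finset.range (q + 1), (colGram ι κ ^ a) j j * (rowGram ι κ ^ (q - a)) i i +
      ∑ c ∈ Finset.range q, ((varMatrix ι κ)ᵀ * rowGram ι κ ^ c) j i *
        ((varMatrix ι κ)ᵀ * rowGram ι κ ^ (q - 1 - c)) j i := by
  have h : pderiv (i, j) (((varMatrix ι κ)ᵀ * rowGram ι κ ^ q) j i) =
      (((varMatrix ι κ)ᵀ * rowGram ι κ ^ q).map (pderiv (i, j))) j i := rfl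
  rw [h, map_pderiv_mul, map_pderiv_pow, Matrix.transpose_map, map_pderiv_varMatrix,
    Matrix.transpose_single, Matrix.add_apply, map_pderiv_rowGram, Matrix.mul_sum,
    Matrix.sum_apply]
  have h1 : (Matrix.single j i (1 : MvPolynomial (ι × κ) ℕ) * rowGram ι κ ^ q) j i = (rowGram ι κ ^ q) i i := by simp
  have h2 : ∀ c ∈ Finset.range q, ((varMatrix ι κ)ᵀ * (rowGram ι κ ^ c *
      (Matrix.single i j (1 : MvPolynomial (ι × κ) ℕ) * (varMatrix ι κ)ᵀ +
        varMatrix ι κ * Matrix.single j i (1 : MvPolynomial (ι × κ) ℕ)) *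
        rowGram ι κ ^ (q - 1 - c))) j i =
      ((varMatrix ι κ)ᵀ * rowGram ι κ ^ c) j i *
        ((varMatrix ι κ)ᵀ * rowGram ι κ ^ (q - 1 - c)) j i +
      (colGram ι κ ^ (c + 1)) j j * (rowGram ι κ ^ (q - (c + 1))) i i := by
    intro c hc
    have e : (varMatrix ι κ)ᵀ * (rowGram ι κ ^ c *
      (Matrix.single i j (1 : MvPolynomial (ι × κ) ℕ) * (varMatrix ι κ)ᵀ +
        varMatrix ι κ * Matrix.single j i (1 : MvPolynomial (ι × κ) ℕ)) *
        rowGram ι κ ^ (q - 1 - c)) =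
        ((varMatrix ι κ)ᵀ * rowGram ι κ ^ c) * Matrix.single i j (1 : MvPolynomial (ι × κ) ℕ) *
          ((varMatrix ι κ)ᵀ * rowGram ι κ ^ (q - 1 - c)) +
        ((varMatrix ι κ)ᵀ * rowGram ι κ ^ c * varMatrix ι κ) * Matrix.single j i (1 : MvPolynomial (ι × κ) ℕ) *
          rowGram ι κ ^ (q - 1 - c) := by
      simp only [Matrix.mul_add, Matrix.add_mul, Matrix.mul_assoc]
    rw [e, Matrix.add_apply, mul_single_mul_apply, mul_single_mul_apply, colGram_pow_succ]
    rw [show q - 1 - c = q - (c + 1) by omega]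
  rw [Finset.sum_congr rfl h2, Finset.sum_add_distrib, h1, Finset.sum_range_succ']
  simp only [pow_zero, Matrix.one_apply_eq, one_mul, Nat.sub_zero]
  ring

theorem pderiv_trace_rowGram_pow (m : ℕ) (i : ι) (j : κ) :
    pderiv (i, j) (rowGram ι κ ^ (m + 1)).trace =
      (2 * (m + 1)) • ((varMatrix ι κ)ᵀ * rowGram ι κ ^ m) j i := by
  have h : pderiv (i, j) (rowGram ι κ ^ (m + 1)).trace =
      ((rowGram ι κ ^ (m + 1)).map (pderiv (i, j))).trace := by
    simp only [Matrix.trace, Matrix.diag_apply, map_sum, Matrix.map_apply]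
  rw [h, map_pderiv_pow, Matrix.trace_sum]
  have hc : ∀ c ∈ Finset.range (m + 1), (rowGram ι κ ^ c * (rowGram ι κ).map (pderiv (i, j)) *
      rowGram ι κ ^ (m + 1 - 1 - c)).trace =
      2 • ((varMatrix ι κ)ᵀ * rowGram ι κ ^ m) j i := by
    intro c hc
    rw [Matrix.trace_mul_comm, ← Matrix.mul_assoc, ← pow_add,
      show m + 1 - 1 - c + c = m by have := Finset.mem_range.1 hc; omega, map_pderiv_rowGram,
      Matrix.mul_add, Matrix.trace_add, Matrix.trace_mul_comm, Matrix.mul_assoc,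
      Matrix.trace_single_mul, ← Matrix.mul_assoc, Matrix.trace_mul_comm, Matrix.trace_single_mul,
      two_nsmul, one_smul, one_smul]
    congr 1
    rw [← Matrix.transpose_apply (rowGram ι κ ^ m * varMatrix ι κ), Matrix.transpose_mul,
      transpose_rowGram_pow]
  rw [Finset.sum_congr rfl hc, Finset.sum_const, Finset.card_range, smul_smul]
  congr 1; ring

/-- The left side is a Frobenius inner product. This collapses both the second sum in the derivative
and the shared-variable error to one trace. -/
theorem sum_mul_transpose_varMatrix_mul_pow (a b : ℕ) :
    ∑ i, ∑ j, ((varMatrix ι κ)ᵀ * rowGram ι κ ^ a) j i * ((varMatrix ι κ)ᵀ * rowGram ι κ ^ b) j i =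
      (rowGram ι κ ^ (a + b + 1)).trace := by
  have h : rowGram ι κ ^ (a + b + 1) =
      ((varMatrix ι κ)ᵀ * rowGram ι κ ^ a)ᵀ * ((varMatrix ι κ)ᵀ * rowGram ι κ ^ b) := by
    rw [Matrix.transpose_mul, Matrix.transpose_transpose, transpose_rowGram_pow, Matrix.mul_assoc,
      ← Matrix.mul_assoc (varMatrix ι κ), ← rowGram, ← pow_succ', ← pow_add]
    congr 1
  rw [h]
  simp only [Matrix.trace, Matrix.diag_apply, Matrix.mul_apply (M := Matrix.transpose _),
    Matrix.transpose_apply]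

theorem trace_rowGram_pow_succ (q : ℕ) :
    (rowGram ι κ ^ (q + 1)).trace =
      ∑ i, ∑ j, X (i, j) * ((varMatrix ι κ)ᵀ * rowGram ι κ ^ q) j i := by
  rw [pow_succ', rowGram, Matrix.mul_assoc, ← rowGram]
  simp only [Matrix.trace, Matrix.diag_apply, Matrix.mul_apply (M := varMatrix ι κ),
    varMatrix_apply]

theorem isHomogeneous_pow {σ : Type*} {M : Matrix ι ι (MvPolynomial σ ℕ)} {d : ℕ}
    (hM : ∀ i j, (M i j).IsHomogeneous d) (b : ℕ) (i j : ι) :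
    ((M ^ b) i j).IsHomogeneous (d * b) := by
  induction b generalizing i j with
  | zero =>
    rw [pow_zero, Matrix.one_apply]
    split_ifs
    · exact isHomogeneous_one _ _
    · exact isHomogeneous_zero _ _ _
  | succ b ih =>
    rw [pow_succ, Matrix.mul_apply]
    exact IsHomogeneous.sum _ _ _ fun k _ => (ih i k).mul (hM k j)

theorem isHomogeneous_rowGram_pow (b : ℕ) (i j : ι) :
    ((rowGram ι κ ^ b) i j).IsHomogeneous (2 * b) := by
  refine isHomogeneous_pow (fun i j => ?_) b i j
  rw [rowGram, Matrix.mul_apply]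
  exact IsHomogeneous.sum _ _ _ fun k _ => (isHomogeneous_X _ _).mul (isHomogeneous_X _ _)

theorem isHomogeneous_colGram_pow (b : ℕ) (i j : κ) :
    ((colGram ι κ ^ b) i j).IsHomogeneous (2 * b) := by
  refine isHomogeneous_pow (fun i j => ?_) b i j
  rw [colGram, Matrix.mul_apply]
  exact IsHomogeneous.sum _ _ _ fun k _ => (isHomogeneous_X _ _).mul (isHomogeneous_X _ _)

/-- Permuting the rows of indeterminates permutes the entries; since the functional is invariant
under renaming, all diagonal entries have equal expectation. -/
theorem rename_rowGram_pow (τ : ι ≃ ι) (b : ℕ) (i i' : ι) :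
    rename (τ.prodCongr (Equiv.refl κ)) ((rowGram ι κ ^ b) i i') =
      (rowGram ι κ ^ b) (τ i) (τ i') := by
  induction b generalizing i i' with
  | zero => simp [Matrix.one_apply, apply_ite (rename _)]
  | succ b ih =>
    rw [pow_succ, Matrix.mul_apply, Matrix.mul_apply, map_sum,
      ← Equiv.sum_comp τ fun k => (rowGram ι κ ^ b) (τ i) k * rowGram ι κ k (τ i')]
    refine Finset.sum_congr rfl fun k _ => ?_
    rw [map_mul, ih]
    congr 1
    simp [rowGram, Matrix.mul_apply, varMatrix_apply]

theorem rename_colGram_pow (τ : κ ≃ κ) (b : ℕ) (j j' : κ) :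
    rename ((Equiv.refl ι).prodCongr τ) ((colGram ι κ ^ b) j j') =
      (colGram ι κ ^ b) (τ j) (τ j') := by
  induction b generalizing j j' with
  | zero => simp [Matrix.one_apply, apply_ite (rename _)]
  | succ b ih =>
    rw [pow_succ, Matrix.mul_apply, Matrix.mul_apply, map_sum,
      ← Equiv.sum_comp τ fun k => (colGram ι κ ^ b) (τ j) k * colGram ι κ k (τ j')]
    refine Finset.sum_congr rfl fun k _ => ?_
    rw [map_mul, ih]
    congr 1
    simp [colGram, Matrix.mul_apply, varMatrix_apply]

theorem card_mul_momentFunctional_rowGram_pow (μ : ℕ → ℝ) (b : ℕ) (i : ι) :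
    (Fintype.card ι : ℝ) * momentFunctional μ ((rowGram ι κ ^ b) i i) =
      momentFunctional μ (rowGram ι κ ^ b).trace := by
  simp only [Matrix.trace, Matrix.diag_apply, map_sum]
  have h : ∀ i' : ι, momentFunctional μ ((rowGram ι κ ^ b) i' i') =
      momentFunctional μ ((rowGram ι κ ^ b) i i) := by
    intro i'
    have := momentFunctional_rename μ ((Equiv.swap i i').prodCongr (Equiv.refl κ))
      ((rowGram ι κ ^ b) i i)
    rwa [rename_rowGram_pow, Equiv.swap_apply_left] at this
  simp [h]

theorem card_mul_momentFunctional_colGram_pow (μ : ℕ → ℝ) (b : ℕ) (j : κ) :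
    (Fintype.card κ : ℝ) * momentFunctional μ ((colGram ι κ ^ b) j j) =
      momentFunctional μ (colGram ι κ ^ b).trace := by
  simp only [Matrix.trace, Matrix.diag_apply, map_sum]
  have h : ∀ j' : κ, momentFunctional μ ((colGram ι κ ^ b) j' j') =
      momentFunctional μ ((colGram ι κ ^ b) j j) := by
    intro j'
    have := momentFunctional_rename μ ((Equiv.refl ι).prodCongr (Equiv.swap j j'))
      ((colGram ι κ ^ b) j j)
    rwa [rename_colGram_pow, Equiv.swap_apply_left] at this
  simp [h]

end Gram

/-! ### The perturbed quadratic recursion for expected traces -/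

theorem sum_comm_cycle {α β δ M : Type*} [AddCommMonoid M] (s : Finset α) (t : Finset β)
    (u : Finset δ) (f : α → β → δ → M) :
    ∑ a ∈ s, ∑ i ∈ t, ∑ j ∈ u, f a i j = ∑ i ∈ t, ∑ j ∈ u, ∑ a ∈ s, f a i j := by
  rw [Finset.sum_comm]
  exact Finset.sum_congr rfl fun i _ => Finset.sum_comm

section Recursion

open MvPolynomial

set_option linter.unusedSectionVars false

variable (ι κ : Type*) [Fintype ι] [Fintype κ] [DecidableEq ι] [DecidableEq κ]

/-- The expected trace of `(X Xᵀ) ^ q` for a matrix with independent entries of moments `μ`. -/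
noncomputable def rowTrace (μ : ℕ → ℝ) (q : ℕ) : ℝ :=
  momentFunctional μ (rowGram ι κ ^ q).trace

/-- The expected trace of `(Xᵀ X) ^ q` for a matrix with independent entries of moments `μ`. -/
noncomputable def colTrace (μ : ℕ → ℝ) (q : ℕ) : ℝ :=
  momentFunctional μ (colGram ι κ ^ q).trace

variable {ι κ}

theorem rowTrace_nonneg {μ : ℕ → ℝ} (hμ : ∀ k, 0 ≤ μ k) (q : ℕ) : 0 ≤ rowTrace ι κ μ q :=
  momentFunctional_nonneg hμ _

theorem rowTrace_zero {μ : ℕ → ℝ} (h : μ 0 = 1) : rowTrace ι κ μ 0 = Fintype.card ι := by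
  rw [rowTrace, pow_zero, Matrix.trace_one, ← nsmul_one, map_nsmul, momentFunctional_one h,
    nsmul_eq_mul, mul_one]

theorem colTrace_zero {μ : ℕ → ℝ} (h : μ 0 = 1) : colTrace ι κ μ 0 = Fintype.card κ := by
  rw [colTrace, pow_zero, Matrix.trace_one, ← nsmul_one, map_nsmul, momentFunctional_one h,
    nsmul_eq_mul, mul_one]

theorem colTrace_succ (μ : ℕ → ℝ) (q : ℕ) : colTrace ι κ μ (q + 1) = rowTrace ι κ μ (q + 1) := by
  rw [colTrace, trace_colGram_pow_succ, rowTrace]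

theorem sum_momentFunctional_pderiv_mul_pderiv (μ : ℕ → ℝ) (a b : ℕ) :
    ∑ e : ι × κ, momentFunctional μ
      (pderiv e (colGram ι κ ^ a).trace * pderiv e (rowGram ι κ ^ b).trace) =
      4 * a * b * rowTrace ι κ μ (a + b - 1) := by
  rcases a with _ | a
  · simp only [pow_zero, Matrix.trace_one, Derivation.map_natCast, zero_mul, map_zero,
      Finset.sum_const_zero, Nat.cast_zero, mul_zero]
  rcases b with _ | b
  · simp only [pow_zero, Matrix.trace_one, Derivation.map_natCast, mul_zero, map_zero,
      Finset.sum_const_zero, Nat.cast_zero, zero_mul]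
  rw [Fintype.sum_prod_type, rowTrace, show a + 1 + (b + 1) - 1 = a + b + 1 by omega,
    ← sum_mul_transpose_varMatrix_mul_pow]
  simp only [trace_colGram_pow_succ, pderiv_trace_rowGram_pow, map_sum, Finset.mul_sum]
  refine Finset.sum_congr rfl fun i _ => Finset.sum_congr rfl fun j _ => ?_
  rw [smul_mul_smul_comm, map_nsmul, nsmul_eq_mul]
  push_cast; ring

variable [Nonempty ι] [Nonempty κ]

theorem momentFunctional_rowGram_pow (μ : ℕ → ℝ) (b : ℕ) (i : ι) :
    momentFunctional μ ((rowGram ι κ ^ b) i i) = rowTrace ι κ μ b / Fintype.card ι := by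
  rw [eq_div_iff (by positivity), mul_comm, card_mul_momentFunctional_rowGram_pow, rowTrace]

theorem momentFunctional_colGram_pow (μ : ℕ → ℝ) (b : ℕ) (j : κ) :
    momentFunctional μ ((colGram ι κ ^ b) j j) = colTrace ι κ μ b / Fintype.card κ := by
  rw [eq_div_iff (by positivity), mul_comm, card_mul_momentFunctional_colGram_pow, colTrace]

theorem sum_momentFunctional_mul (μ : ℕ → ℝ) (a b : ℕ) :
    ∑ i : ι, ∑ j : κ, momentFunctional μ ((colGram ι κ ^ a) j j) *
      momentFunctional μ ((rowGram ι κ ^ b) i i) = colTrace ι κ μ a * rowTrace ι κ μ b := by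
  simp only [momentFunctional_rowGram_pow, momentFunctional_colGram_pow, Finset.sum_const,
    Finset.card_univ, nsmul_eq_mul]
  field_simp

/-- For fixed `j` the factor from `W^b` has expectation `T_b / n` for every `i`, and Euler bounds
the sum over `i` of the other factor by its degree `2a`; this yields `2a/n`, and symmetrically
`2b/N`. The shared-variable term is a sum of products of derivatives of traces, each a multiple of
an entry of `Xᵀ W^m`. -/
theorem sum_covarianceBound_le {C : ℝ} (hC : 0 ≤ C) (a b : ℕ) :
    ∑ i : ι, ∑ j : κ, covarianceBound C (i, j) ((colGram ι κ ^ a) j j) ((rowGram ι κ ^ b) i i) ≤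
      C * (2 * a / Fintype.card ι + 2 * b / Fintype.card κ) *
        (colTrace ι κ (domMoment C) a * rowTrace ι κ (domMoment C) b) +
      C ^ 2 * (4 * a * b * rowTrace ι κ (domMoment C) (a + b - 1)) := by
  set M := domMoment C with hM
  have hM0 : ∀ k, 0 ≤ M k := domMoment_nonneg hC
  have h1 : ∑ i : ι, ∑ j : κ, momentFunctional M (X (i, j) * pderiv (i, j) ((colGram ι κ ^ a) j j)) *
      momentFunctional M ((rowGram ι κ ^ b) i i) ≤
      2 * a / Fintype.card ι * (colTrace ι κ M a * rowTrace ι κ M b) := by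
    rw [Finset.sum_comm]
    calc ∑ j : κ, ∑ i : ι, momentFunctional M (X (i, j) * pderiv (i, j) ((colGram ι κ ^ a) j j)) *
          momentFunctional M ((rowGram ι κ ^ b) i i)
        = ∑ j : κ, (∑ e ∈ Finset.univ.image (fun i : ι => (i, j)),
            momentFunctional M (X e * pderiv e ((colGram ι κ ^ a) j j))) *
              (rowTrace ι κ M b / Fintype.card ι) := by
          refine Finset.sum_congr rfl fun j _ => ?_
          rw [Finset.sum_image (fun _ _ _ _ h => congrArg Prod.fst h), Finset.sum_mul]
          simp only [momentFunctional_rowGram_pow]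
      _ ≤ ∑ j : κ, ((2 * a : ℕ) * momentFunctional M ((colGram ι κ ^ a) j j)) *
              (rowTrace ι κ M b / Fintype.card ι) := by
          refine Finset.sum_le_sum fun j _ => mul_le_mul_of_nonneg_right
            (sum_momentFunctional_X_mul_pderiv_le hM0 (isHomogeneous_colGram_pow a j j) _)
            (div_nonneg (rowTrace_nonneg hM0 b) (by positivity))
      _ = _ := by
          rw [← Finset.sum_mul, ← Finset.mul_sum, colTrace]
          simp only [Matrix.trace, Matrix.diag_apply, map_sum]
          push_cast; ring
  have h2 : ∑ i : ι, ∑ j : κ, momentFunctional M ((colGram ι κ ^ a) j j) *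
      momentFunctional M (X (i, j) * pderiv (i, j) ((rowGram ι κ ^ b) i i)) ≤
      2 * b / Fintype.card κ * (colTrace ι κ M a * rowTrace ι κ M b) := by
    calc ∑ i : ι, ∑ j : κ, momentFunctional M ((colGram ι κ ^ a) j j) *
          momentFunctional M (X (i, j) * pderiv (i, j) ((rowGram ι κ ^ b) i i))
        = ∑ i : ι, (colTrace ι κ M a / Fintype.card κ) *
            ∑ e ∈ Finset.univ.image (fun j : κ => (i, j)),
              momentFunctional M (X e * pderiv e ((rowGram ι κ ^ b) i i)) := by
          refine Finset.sum_congr rfl fun i _ => ?_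
          rw [Finset.sum_image (fun _ _ _ _ h => congrArg Prod.snd h), Finset.mul_sum]
          simp only [momentFunctional_colGram_pow]
      _ ≤ ∑ i : ι, (colTrace ι κ M a / Fintype.card κ) *
            ((2 * b : ℕ) * momentFunctional M ((rowGram ι κ ^ b) i i)) := by
          refine Finset.sum_le_sum fun i _ => mul_le_mul_of_nonneg_left
            (sum_momentFunctional_X_mul_pderiv_le hM0 (isHomogeneous_rowGram_pow b i i) _)
            (div_nonneg (momentFunctional_nonneg hM0 _) (by positivity))
      _ = _ := by
          rw [← Finset.mul_sum, ← Finset.mul_sum]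
          rw [rowTrace]
          simp only [Matrix.trace, Matrix.diag_apply, map_sum]
          push_cast; ring
  have h3 : ∑ i : ι, ∑ j : κ, ∑ e, momentFunctional M
      (pderiv e ((colGram ι κ ^ a) j j) * pderiv e ((rowGram ι κ ^ b) i i)) =
      4 * a * b * rowTrace ι κ M (a + b - 1) := by
    rw [← sum_momentFunctional_pderiv_mul_pderiv]
    simp only [Matrix.trace, Matrix.diag_apply, map_sum, Finset.sum_mul_sum]
    rw [Finset.sum_comm, Finset.sum_comm' (t' := Finset.univ) (s' := fun _ => Finset.univ)
      (by simp)]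
    simp_rw [Finset.sum_comm (s := (Finset.univ : Finset κ)) (t := (Finset.univ : Finset (ι × κ)))]
    rw [Finset.sum_comm]
    refine Finset.sum_congr rfl fun e _ => ?_
    rw [Finset.sum_comm]
  simp only [covarianceBound, Finset.sum_add_distrib, ← Finset.mul_sum]
  rw [h3]
  have h4 := mul_le_mul_of_nonneg_left (add_le_add h1 h2) hC
  linarith

/-- Integration by parts followed by decoupling of the closed words. The `q` products of open words
contribute at most `C T_q` each. -/
theorem rowTrace_succ_le {C : ℝ} (hC : 1 ≤ C) (q : ℕ) :
    rowTrace ι κ (domMoment C) (q + 1) ≤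
      ∑ a ∈ Finset.range (q + 1),
        (colTrace ι κ (domMoment C) a * rowTrace ι κ (domMoment C) (q - a) +
          (C * (2 * a / Fintype.card ι + 2 * (q - a : ℕ) / Fintype.card κ) *
            (colTrace ι κ (domMoment C) a * rowTrace ι κ (domMoment C) (q - a)) +
          C ^ 2 * (4 * a * (q - a : ℕ) * rowTrace ι κ (domMoment C) (q - 1)))) +
      C * q * rowTrace ι κ (domMoment C) q := by
  set M := domMoment C with hM
  have hC0 : 0 ≤ C := by linarith
  have hM0 : ∀ k, 0 ≤ M k := domMoment_nonneg hC0
  have h1 : rowTrace ι κ M (q + 1) =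
      (∑ a ∈ Finset.range (q + 1), ∑ i : ι, ∑ j : κ,
        tiltedFunctional M C (i, j) ((colGram ι κ ^ a) j j * (rowGram ι κ ^ (q - a)) i i)) +
      ∑ c ∈ Finset.range q, ∑ i : ι, ∑ j : κ, tiltedFunctional M C (i, j)
        (((varMatrix ι κ)ᵀ * rowGram ι κ ^ c) j i *
          ((varMatrix ι κ)ᵀ * rowGram ι κ ^ (q - 1 - c)) j i) := by
    rw [rowTrace, trace_rowGram_pow_succ]
    rw [sum_comm_cycle (Finset.range (q + 1)), sum_comm_cycle (Finset.range q)]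
    simp only [← Finset.sum_add_distrib, map_sum]
    refine Finset.sum_congr rfl fun i _ => Finset.sum_congr rfl fun j _ => ?_
    rw [hM, momentFunctional_X_mul, pderiv_transpose_varMatrix_mul_pow, map_add, map_sum, map_sum]
  rw [h1]
  refine add_le_add (Finset.sum_le_sum fun a ha => ?_) ?_
  · have h2 := sum_covarianceBound_le (ι := ι) (κ := κ) hC0 a (q - a)
    rw [show a + (q - a) - 1 = q - 1 by have := Finset.mem_range.1 ha; omega] at h2
    refine le_trans ?_ (add_le_add_right h2 _)
    rw [← sum_momentFunctional_mul]
    simp only [← Finset.sum_add_distrib]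
    exact Finset.sum_le_sum fun i _ => Finset.sum_le_sum fun j _ =>
      tiltedFunctional_mul_le hC _ _ _
  · calc _ ≤ ∑ c ∈ Finset.range q, C * rowTrace ι κ M q := by
          refine Finset.sum_le_sum fun c hc => ?_
          have hcq : c + (q - 1 - c) + 1 = q := by have := Finset.mem_range.1 hc; omega
          have h3 := sum_mul_transpose_varMatrix_mul_pow (ι := ι) (κ := κ) c (q - 1 - c)
          rw [hcq] at h3
          rw [rowTrace, ← h3]
          simp only [map_sum, Finset.mul_sum]
          exact Finset.sum_le_sum fun i _ => Finset.sum_le_sum fun j _ =>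
            tiltedFunctional_le hM0 hC _ _
      _ = C * q * rowTrace ι κ M q := by simp; ring

/-- Here the products of open words are nonnegative and are dropped. The errors are still measured
with the dominating moments, so the upper bound has to be proved first. -/
theorem le_rowTrace_succ {C : ℝ} (hC : 1 ≤ C) {μ : ℕ → ℝ} (hμ : ∀ k, 0 ≤ μ k)
    (h0 : μ 0 = 1) (h2 : μ 2 = 1) (hle : ∀ k, μ k ≤ domMoment C k) (q : ℕ) :
    ∑ a ∈ Finset.range (q + 1),
        (colTrace ι κ μ a * rowTrace ι κ μ (q - a) -
          (C * (2 * a / Fintype.card ι + 2 * (q - a : ℕ) / Fintype.card κ) *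
            (colTrace ι κ (domMoment C) a * rowTrace ι κ (domMoment C) (q - a)) +
          C ^ 2 * (4 * a * (q - a : ℕ) * rowTrace ι κ (domMoment C) (q - 1)))) ≤
      rowTrace ι κ μ (q + 1) := by
  have hC0 : 0 ≤ C := by linarith
  have h1 : (∑ a ∈ Finset.range (q + 1), ∑ i : ι, ∑ j : κ,
        tiltedFunctional μ 0 (i, j) ((colGram ι κ ^ a) j j * (rowGram ι κ ^ (q - a)) i i)) ≤
      rowTrace ι κ μ (q + 1) := by
    rw [rowTrace, trace_rowGram_pow_succ, sum_comm_cycle]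
    simp only [map_sum]
    refine Finset.sum_le_sum fun i _ => Finset.sum_le_sum fun j _ => ?_
    refine le_trans ?_ (tiltedFunctional_zero_le hμ h0 h2 _ _)
    rw [pderiv_transpose_varMatrix_mul_pow, map_add, map_sum]
    exact le_add_of_nonneg_right (tiltedFunctional_nonneg hμ le_rfl _ _)
  refine le_trans (Finset.sum_le_sum fun a ha => ?_) h1
  have h2 := sum_covarianceBound_le (ι := ι) (κ := κ) hC0 a (q - a)
  rw [show a + (q - a) - 1 = q - 1 by have := Finset.mem_range.1 ha; omega] at h2
  refine le_trans (sub_le_sub_left h2 _) ?_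
  rw [← sum_momentFunctional_mul, sub_le_iff_le_add]
  simp only [← Finset.sum_add_distrib]
  exact Finset.sum_le_sum fun i _ => Finset.sum_le_sum fun j _ =>
    momentFunctional_mul_le hC hμ h0 hle _ _ _

end Recursion

/-! ### Solving the recursion with a relative error -/

theorem mpSeq_succ_range (c : ℝ) (q : ℕ) :
    mpSeq c (q + 1) = ∑ a ∈ Finset.range (q + 1),
      (if a = 0 then 1 else c) * mpSeq c a * mpSeq c (q - a) := by
  rw [mpSeq_succ, Finset.Nat.sum_antidiagonal_eq_sum_range_succ_mk]

theorem mpSeq_pos {c : ℝ} (hc : 0 < c) (q : ℕ) : 0 < mpSeq c q := by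
  induction q using Nat.strong_induction_on with
  | _ q ih =>
    rcases q with _ | q
    · simp [mpSeq_zero]
    · rw [mpSeq_succ_range]
      refine Finset.sum_pos (fun a ha => ?_) (by simp)
      have h1 := ih a (Finset.mem_range.1 ha)
      have h2 := ih (q - a) (by omega)
      have h3 : 0 < if a = 0 then 1 else c := by split_ifs <;> simp [hc]
      positivity

theorem mpSeq_le_succ {c : ℝ} (hc : 0 < c) (q : ℕ) : mpSeq c q ≤ mpSeq c (q + 1) := by
  rw [mpSeq_succ_range]
  have h := Finset.single_le_sum (s := Finset.range (q + 1))
    (f := fun a => (if a = 0 then 1 else c) * mpSeq c a * mpSeq c (q - a))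
    (fun a _ => by
      have h1 := mpSeq_pos hc a
      have h2 := mpSeq_pos hc (q - a)
      have h3 : 0 < if a = 0 then 1 else c := by split_ifs <;> simp [hc]
      positivity) (Finset.mem_range.2 (Nat.succ_pos q))
  simpa [mpSeq_zero] using h

/-- The main term of the expected trace of `(X Xᵀ) ^ q`. -/
noncomputable def mpRow (n N : ℝ) (q : ℕ) : ℝ := n * N ^ q * mpSeq (n / N) q

/-- The main term of the expected trace of `(Xᵀ X) ^ q`. -/
noncomputable def mpCol (n N : ℝ) (q : ℕ) : ℝ :=
  N ^ (q + 1) * ((if q = 0 then 1 else n / N) * mpSeq (n / N) q)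

theorem mpRow_pos {n N : ℝ} (hn : 0 < n) (hN : 0 < N) (q : ℕ) : 0 < mpRow n N q :=
  mul_pos (by positivity) (mpSeq_pos (by positivity) q)

theorem mpCol_pos {n N : ℝ} (hn : 0 < n) (hN : 0 < N) (q : ℕ) : 0 < mpCol n N q := by
  have h3 : 0 < if q = 0 then 1 else n / N := by split_ifs <;> positivity
  exact mul_pos (by positivity) (mul_pos h3 (mpSeq_pos (by positivity) q))

theorem mpCol_succ {n N : ℝ} (hn : 0 < n) (hN : 0 < N) (q : ℕ) : mpCol n N (q + 1) = mpRow n N (q + 1) := by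
  simp only [mpCol, mpRow, if_neg (Nat.succ_ne_zero q)]
  field_simp
  ring

/-- The main terms solve the unperturbed recursion exactly; the weight `1` at index `0` in `mpSeq`
reflects that `Xᵀ X` has trace `N` rather than `n` at power `0`. -/
theorem sum_mpCol_mul_mpRow (n N : ℝ) (q : ℕ) :
    ∑ a ∈ Finset.range (q + 1), mpCol n N a * mpRow n N (q - a) = mpRow n N (q + 1) := by
  rw [mpRow, mpSeq_succ_range, Finset.mul_sum]
  refine Finset.sum_congr rfl fun a ha => ?_
  have h : N ^ (q + 1) = N ^ (a + 1) * N ^ (q - a) := by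
    rw [← pow_add]; congr 1; have := Finset.mem_range.1 ha; omega
  rw [mpCol, mpRow, h]; ring

/-- Each lost power of `W` gains a factor `1/N`, which makes the lower-order traces in the recursion
negligible. -/
theorem mul_mpRow_le {n N : ℝ} (hn : 0 < n) (hN : 0 < N) (q : ℕ) : N * mpRow n N q ≤ mpRow n N (q + 1) := by
  simp only [mpRow, pow_succ]
  have := mul_le_mul_of_nonneg_left (mpSeq_le_succ (c := n / N) (by positivity) q)
    (show 0 ≤ n * (N ^ q * N) by positivity)
  linarith

/-- The constant in the exponent of the upper bound for the expected traces. -/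
noncomputable def growthConst (C κ : ℝ) : ℝ := 2 * C * (1 + κ) + 4 * C ^ 2 * κ ^ 2 + C * κ

theorem growthConst_nonneg {C κ : ℝ} (hC : 0 ≤ C) (hκ : 0 ≤ κ) : 0 ≤ growthConst C κ := by
  unfold growthConst; positivity

/-- The three summands of `growthConst` come from the tilt, the shared variables and the open words.
The last two use `mul_mpRow_le` twice and once, with `1/N ≤ κ/n`. -/
theorem recursion_error_le {n N C κ s : ℝ} (hn : 0 < n) (hN : 0 < N) (hC : 0 ≤ C) (hκ : 0 ≤ κ)
    (hnN : n ≤ κ * N) {T T' : ℕ → ℝ} (hT0 : ∀ q, 0 ≤ T q) (q : ℕ)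
    (hq : ((q : ℝ) + 1) ^ 2 ≤ n) (hTT : ∀ a ≤ q, T' a * T (q - a) ≤
      mpCol n N a * mpRow n N (q - a) * s) (hT : ∀ a ≤ q, T a ≤ mpRow n N a * s) :
    ∑ a ∈ Finset.range (q + 1),
        (C * (2 * a / n + 2 * (q - a : ℕ) / N) * (T' a * T (q - a)) +
          C ^ 2 * (4 * a * (q - a : ℕ) * T (q - 1))) + C * q * T q ≤
      mpRow n N (q + 1) * s * (growthConst C κ * (q + 1) / n) := by
  have hs : 0 ≤ s := by
    have := (hT0 q).trans (hT q le_rfl)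
    exact nonneg_of_mul_nonneg_right this (mpRow_pos hn hN q)
  have hinv : 1 / N ≤ κ / n := by rw [div_le_div_iff₀ hN hn]; linarith
  have hR := mpRow_pos hn hN (q + 1)
  have hq0 : (0 : ℝ) ≤ q := Nat.cast_nonneg q
  have hRq : mpRow n N q ≤ κ / n * mpRow n N (q + 1) := by
    have h := mul_mpRow_le hn hN q
    calc mpRow n N q = 1 / N * (N * mpRow n N q) := by field_simp
      _ ≤ κ / n * mpRow n N (q + 1) := by
        have := (mpRow_pos hn hN q).le
        gcongr
  have hTq1 : (q : ℝ) * T (q - 1) ≤ q * ((κ / n) ^ 2 * (mpRow n N (q + 1) * s)) := by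
    rcases q with _ | q
    · simp
    · refine mul_le_mul_of_nonneg_left ?_ hq0
      rw [Nat.add_sub_cancel]
      have h := mul_mpRow_le hn hN q
      have h1 : mpRow n N q ≤ κ / n * mpRow n N (q + 1) := by
        calc mpRow n N q = 1 / N * (N * mpRow n N q) := by field_simp
          _ ≤ κ / n * mpRow n N (q + 1) := by
            have := (mpRow_pos hn hN q).le
            gcongr
      calc T q ≤ mpRow n N q * s := hT q (Nat.le_succ q)
        _ ≤ (κ / n * (κ / n * mpRow n N (q + 1 + 1))) * s := by gcongr; exact h1.trans (by gcongr)
        _ = _ := by ring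
  have h1 : ∀ a ∈ Finset.range (q + 1),
      C * (2 * a / n + 2 * (q - a : ℕ) / N) * (T' a * T (q - a)) +
          C ^ 2 * (4 * a * (q - a : ℕ) * T (q - 1)) ≤
      2 * C * (1 + κ) * q / n * s * (mpCol n N a * mpRow n N (q - a)) +
        4 * C ^ 2 * κ ^ 2 * q ^ 2 / n ^ 2 * (mpRow n N (q + 1) * s) := by
    intro a ha
    have haq : a ≤ q := Nat.lt_succ_iff.1 (Finset.mem_range.1 ha)
    have ha' : (a : ℝ) ≤ q := by exact_mod_cast haq
    have hqa : ((q - a : ℕ) : ℝ) ≤ q := by exact_mod_cast Nat.sub_le q a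
    have e1 : 2 * (a : ℝ) / n + 2 * (q - a : ℕ) / N ≤ 2 * (1 + κ) * q / n := by
      have i1 : 2 * (a : ℝ) / n ≤ 2 * q / n := by gcongr
      have i2 : 2 * ((q - a : ℕ) : ℝ) / N ≤ 2 * q * (κ / n) := by
        calc 2 * ((q - a : ℕ) : ℝ) / N = 2 * ((q - a : ℕ) : ℝ) * (1 / N) := by ring
          _ ≤ 2 * q * (κ / n) := by gcongr
      calc _ ≤ 2 * q / n + 2 * q * (κ / n) := add_le_add i1 i2
        _ = _ := by ring
    have hpos : 0 ≤ mpCol n N a * mpRow n N (q - a) * s :=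
      mul_nonneg (mul_pos (mpCol_pos hn hN a) (mpRow_pos hn hN (q - a))).le hs
    refine add_le_add ?_ ?_
    · calc C * (2 * a / n + 2 * (q - a : ℕ) / N) * (T' a * T (q - a))
          ≤ C * (2 * a / n + 2 * (q - a : ℕ) / N) * (mpCol n N a * mpRow n N (q - a) * s) := by
            exact mul_le_mul_of_nonneg_left (hTT a haq) (by positivity)
        _ ≤ C * (2 * (1 + κ) * q / n) * (mpCol n N a * mpRow n N (q - a) * s) := by gcongr
        _ = _ := by ring
    · calc C ^ 2 * (4 * a * (q - a : ℕ) * T (q - 1)) ≤ C ^ 2 * (4 * q * q * T (q - 1)) := by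
            have := hT0 (q - 1)
            gcongr
        _ = 4 * C ^ 2 * q * (q * T (q - 1)) := by ring
        _ ≤ 4 * C ^ 2 * q * (q * ((κ / n) ^ 2 * (mpRow n N (q + 1) * s))) := by gcongr
        _ = _ := by ring
  have h2 : C * q * T q ≤ C * κ * q / n * (mpRow n N (q + 1) * s) := by
    calc C * q * T q ≤ C * q * (mpRow n N q * s) := by gcongr; exact hT q le_rfl
      _ ≤ C * q * (κ / n * mpRow n N (q + 1) * s) := by gcongr
      _ = _ := by ring
  refine (add_le_add (Finset.sum_le_sum h1) h2).trans ?_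
  rw [Finset.sum_add_distrib, ← Finset.mul_sum, sum_mpCol_mul_mpRow n N, Finset.sum_const,
    Finset.card_range, nsmul_eq_mul]
  have hRs : 0 ≤ mpRow n N (q + 1) * s := mul_nonneg hR.le hs
  have h3 : 2 * C * (1 + κ) * q / n + ((q : ℝ) + 1) * (4 * C ^ 2 * κ ^ 2 * q ^ 2 / n ^ 2) +
      C * κ * q / n ≤ growthConst C κ * (q + 1) / n := by
    have i1 : 2 * C * (1 + κ) * q / n ≤ 2 * C * (1 + κ) * (q + 1) / n := by gcongr; linarith
    have i2 : C * κ * q / n ≤ C * κ * (q + 1) / n := by gcongr; linarith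
    -- Here `q² ≤ n` is essential: the shared-variable terms add up to order `q³/n²`, which must be
    -- at most of order `q/n`.
    have i3 : ((q : ℝ) + 1) * (4 * C ^ 2 * κ ^ 2 * q ^ 2 / n ^ 2) ≤
        4 * C ^ 2 * κ ^ 2 * (q + 1) / n := by
      have : (q : ℝ) ^ 2 ≤ n := by nlinarith
      calc ((q : ℝ) + 1) * (4 * C ^ 2 * κ ^ 2 * q ^ 2 / n ^ 2)
          ≤ ((q : ℝ) + 1) * (4 * C ^ 2 * κ ^ 2 * n / n ^ 2) := by gcongr
        _ = _ := by field_simp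
    calc _ ≤ 2 * C * (1 + κ) * (q + 1) / n + 4 * C ^ 2 * κ ^ 2 * (q + 1) / n +
          C * κ * (q + 1) / n := by linarith
      _ = _ := by rw [growthConst]; ring
  have h4 := mul_le_mul_of_nonneg_right h3 hRs
  push_cast
  linarith

/-- The exponent `K q²/n` is superadditive, since `a² + (q-a)² ≤ q²`, so it passes through the
convolution. The new error factor `1 + K (q+1)/n` is absorbed because `q² + (q+1) ≤ (q+1)²`. -/
theorem upper_of_recursion {n N C κ : ℝ} (hn : 0 < n) (hN : 0 < N) (hC : 0 ≤ C) (hκ : 0 ≤ κ)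
    (hnN : n ≤ κ * N) {T T' : ℕ → ℝ} (hT : ∀ q, 0 ≤ T q) (hT0 : T 0 = n) (hT0' : T' 0 = N)
    (hTs : ∀ q, T' (q + 1) = T (q + 1))
    (hrec : ∀ q, T (q + 1) ≤ ∑ a ∈ Finset.range (q + 1), (T' a * T (q - a) +
      (C * (2 * a / n + 2 * (q - a : ℕ) / N) * (T' a * T (q - a)) +
          C ^ 2 * (4 * a * (q - a : ℕ) * T (q - 1)))) + C * q * T q) (q : ℕ)
    (hq : (q : ℝ) ^ 2 ≤ n) :
    T q ≤ mpRow n N q * Real.exp (growthConst C κ * q ^ 2 / n) ∧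
      T' q ≤ mpCol n N q * Real.exp (growthConst C κ * q ^ 2 / n) := by
  set K := growthConst C κ with hK
  have hK0 : 0 ≤ K := growthConst_nonneg hC hκ
  induction q using Nat.strong_induction_on with
  | _ q ih =>
    rcases q with _ | q
    · simp [hT0, hT0', mpRow, mpCol, mpSeq_zero]
    · rw [hTs, mpCol_succ hn hN, and_self]
      push_cast at hq ⊢
      set s := Real.exp (K * (q : ℝ) ^ 2 / n) with hs
      have hq0 : (0 : ℝ) ≤ q := Nat.cast_nonneg q
      have ih' : ∀ a ≤ q, T a ≤ mpRow n N a * Real.exp (K * a ^ 2 / n) ∧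
          T' a ≤ mpCol n N a * Real.exp (K * a ^ 2 / n) := by
        intro a ha
        refine ih a (Nat.lt_succ_of_le ha) ?_
        have : (a : ℝ) ≤ q := by exact_mod_cast ha
        have h0 : (0 : ℝ) ≤ a := Nat.cast_nonneg a
        nlinarith
      have hTa : ∀ a ≤ q, T a ≤ mpRow n N a * s := by
        intro a ha
        have haq : (a : ℝ) ≤ q := by exact_mod_cast ha
        have := (mpRow_pos hn hN a).le
        exact (ih' a ha).1.trans (by rw [hs]; gcongr)
      have hTT : ∀ a ≤ q, T' a * T (q - a) ≤ mpCol n N a * mpRow n N (q - a) * s := by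
        intro a ha
        have h1 := (ih' a ha).2
        have h2 := (ih' (q - a) (Nat.sub_le q a)).1
        have h3 := (mpCol_pos hn hN a).le
        have h4 := (mpRow_pos hn hN (q - a)).le
        calc T' a * T (q - a) ≤ (mpCol n N a * Real.exp (K * a ^ 2 / n)) *
              (mpRow n N (q - a) * Real.exp (K * ((q - a : ℕ) : ℝ) ^ 2 / n)) :=
              mul_le_mul h1 h2 (hT _) (by positivity)
          _ = mpCol n N a * mpRow n N (q - a) *
              Real.exp (K * a ^ 2 / n + K * ((q - a : ℕ) : ℝ) ^ 2 / n) := by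
              rw [Real.exp_add]; ring
          _ ≤ mpCol n N a * mpRow n N (q - a) * s := by
              refine mul_le_mul_of_nonneg_left ?_ (by positivity)
              rw [hs, Real.exp_le_exp, ← add_div, ← mul_add]
              have hsub : ((q - a : ℕ) : ℝ) = q - a := Nat.cast_sub ha
              have haq : (a : ℝ) ≤ q := by exact_mod_cast ha
              have ha0 : (0 : ℝ) ≤ a := Nat.cast_nonneg a
              gcongr
              rw [hsub]; nlinarith
      have herr := recursion_error_le hn hN hC hκ hnN hT q hq hTT hTa
      have hmain : ∑ a ∈ Finset.range (q + 1), T' a * T (q - a) ≤ mpRow n N (q + 1) * s := by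
        rw [← sum_mpCol_mul_mpRow n N, Finset.sum_mul]
        exact Finset.sum_le_sum fun a ha => hTT a (Nat.lt_succ_iff.1 (Finset.mem_range.1 ha))
      have hfin := hrec q
      rw [Finset.sum_add_distrib] at hfin
      have hR := (mpRow_pos hn hN (q + 1)).le
      calc T (q + 1) ≤ mpRow n N (q + 1) * s * (K * (q + 1) / n + 1) := by linarith
        _ ≤ mpRow n N (q + 1) * s * Real.exp (K * (q + 1) / n) := by
            have := (Real.exp_pos (K * (q : ℝ) ^ 2 / n)).le
            gcongr
            exact Real.add_one_le_exp _
        _ = mpRow n N (q + 1) * Real.exp (K * (q : ℝ) ^ 2 / n + K * (q + 1) / n) := by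
            rw [Real.exp_add, hs]; ring
        _ ≤ _ := by
            rw [← add_div, ← mul_add]
            gcongr
            nlinarith

/-- In the range `q² ≤ n` a product of two upper bounds loses at most `exp (2K)`, whence the
constant `K exp (2K)`. Quadratic growth of the defect again makes the induction close, and the
second size condition keeps the lower bounds nonnegative, so that they may be multiplied. -/
theorem lower_of_recursion {n N C κ : ℝ} (hn : 0 < n) (hN : 0 < N) (hC : 0 ≤ C) (hκ : 0 ≤ κ)
    (hnN : n ≤ κ * N) {T T' U U' : ℕ → ℝ} (hT : ∀ q, 0 ≤ T q) (hU0 : U 0 = n) (hU0' : U' 0 = N)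
    (hUs : ∀ q, U' (q + 1) = U (q + 1))
    (hup : ∀ q : ℕ, (q : ℝ) ^ 2 ≤ n →
      T q ≤ mpRow n N q * Real.exp (growthConst C κ * q ^ 2 / n) ∧
      T' q ≤ mpCol n N q * Real.exp (growthConst C κ * q ^ 2 / n))
    (hrec : ∀ q, ∑ a ∈ Finset.range (q + 1), (U' a * U (q - a) -
      (C * (2 * a / n + 2 * (q - a : ℕ) / N) * (T' a * T (q - a)) +
          C ^ 2 * (4 * a * (q - a : ℕ) * T (q - 1)))) ≤ U (q + 1)) (q : ℕ)
    (hq : (q : ℝ) ^ 2 ≤ n)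
    (hqK : growthConst C κ * Real.exp (growthConst C κ * 2) * q ^ 2 ≤ n) :
    mpRow n N q * (1 - growthConst C κ * Real.exp (growthConst C κ * 2) * q ^ 2 / n) ≤ U q ∧
    mpCol n N q * (1 - growthConst C κ * Real.exp (growthConst C κ * 2) * q ^ 2 / n) ≤ U' q := by
  have hK0 : 0 ≤ growthConst C κ := growthConst_nonneg hC hκ
  set K := growthConst C κ with hK
  set s := Real.exp (K * 2) with hs
  have hs0 : 0 < s := Real.exp_pos _
  have hL0 : 0 ≤ K * s := by positivity
  induction q using Nat.strong_induction_on with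
  | _ q ih =>
    rcases q with _ | q
    · simp [hU0, hU0', mpRow, mpCol, mpSeq_zero]
    · rw [hUs, mpCol_succ hn hN, and_self]
      push_cast at hq hqK ⊢
      have hq0 : (0 : ℝ) ≤ q := Nat.cast_nonneg q
      have hle : ∀ a ≤ q, (a : ℝ) ^ 2 ≤ ((q : ℝ) + 1) ^ 2 := by
        intro a ha
        have : (a : ℝ) ≤ q := by exact_mod_cast ha
        gcongr; linarith
      have hexp : ∀ a ≤ q, K * (a : ℝ) ^ 2 / n ≤ K := by
        intro a ha
        rw [div_le_iff₀ hn]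
        exact mul_le_mul_of_nonneg_left ((hle a ha).trans hq) hK0
      have hTa : ∀ a ≤ q, T a ≤ mpRow n N a * s := by
        intro a ha
        have := (mpRow_pos hn hN a).le
        refine (hup a ((hle a ha).trans hq)).1.trans ?_
        rw [hs]; gcongr
        linarith [hexp a ha]
      have hTT : ∀ a ≤ q, T' a * T (q - a) ≤ mpCol n N a * mpRow n N (q - a) * s := by
        intro a ha
        have hb := Nat.sub_le q a
        have h1 := (hup a ((hle a ha).trans hq)).2
        have h2 := (hup (q - a) ((hle _ hb).trans hq)).1
        have h3 := (mpCol_pos hn hN a).le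
        have h4 := (mpRow_pos hn hN (q - a)).le
        calc T' a * T (q - a) ≤ (mpCol n N a * Real.exp (K * a ^ 2 / n)) *
              (mpRow n N (q - a) * Real.exp (K * ((q - a : ℕ) : ℝ) ^ 2 / n)) :=
              mul_le_mul h1 h2 (hT _) (by positivity)
          _ = mpCol n N a * mpRow n N (q - a) *
              Real.exp (K * a ^ 2 / n + K * ((q - a : ℕ) : ℝ) ^ 2 / n) := by
              rw [Real.exp_add]; ring
          _ ≤ mpCol n N a * mpRow n N (q - a) * s := by
              rw [hs]; gcongr
              linarith [hexp a ha, hexp _ hb]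
      have herr := recursion_error_le hn hN hC hκ hnN hT q hq hTT hTa
      -- The common error bound includes the open-word term, which is absent from the lower
      -- recursion.
      have hCT : 0 ≤ C * q * T q := mul_nonneg (by positivity) (hT q)
      have hmain : mpRow n N (q + 1) * (1 - K * s * q ^ 2 / n) ≤
          ∑ a ∈ Finset.range (q + 1), U' a * U (q - a) := by
        rw [← sum_mpCol_mul_mpRow n N, Finset.sum_mul]
        refine Finset.sum_le_sum fun a ha => ?_
        have haq := Nat.lt_succ_iff.1 (Finset.mem_range.1 ha)
        have hb := Nat.sub_le q a
        have hfrac : ∀ b ≤ q, K * s * (b : ℝ) ^ 2 / n ≤ 1 := by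
          intro b hb
          rw [div_le_one hn]
          exact (mul_le_mul_of_nonneg_left (hle b hb) hL0).trans hqK
        have ha1 := (ih a (Nat.lt_succ_of_le haq) ((hle a haq).trans hq)
          ((mul_le_mul_of_nonneg_left (hle a haq) hL0).trans hqK)).2
        have hb1 := (ih (q - a) (Nat.lt_succ_of_le hb) ((hle _ hb).trans hq)
          ((mul_le_mul_of_nonneg_left (hle _ hb) hL0).trans hqK)).1
        have h3 := (mpCol_pos hn hN a).le
        have h4 := (mpRow_pos hn hN (q - a)).le
        have p1 : 0 ≤ 1 - K * s * (a : ℝ) ^ 2 / n := by linarith [hfrac a haq]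
        have p2 : 0 ≤ 1 - K * s * ((q - a : ℕ) : ℝ) ^ 2 / n := by linarith [hfrac _ hb]
        refine le_trans ?_ (mul_le_mul ha1 hb1 (mul_nonneg h4 p2)
          ((mul_nonneg h3 p1).trans ha1))
        have hsub : ((q - a : ℕ) : ℝ) = q - a := Nat.cast_sub haq
        have haq' : (a : ℝ) ≤ q := by exact_mod_cast haq
        have ha0 : (0 : ℝ) ≤ a := Nat.cast_nonneg a
        have hkey : 1 - K * s * (q : ℝ) ^ 2 / n ≤
            (1 - K * s * (a : ℝ) ^ 2 / n) * (1 - K * s * ((q - a : ℕ) : ℝ) ^ 2 / n) := by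
          have i1 : K * s * (a : ℝ) ^ 2 / n + K * s * ((q - a : ℕ) : ℝ) ^ 2 / n ≤
              K * s * (q : ℝ) ^ 2 / n := by
            rw [← add_div, ← mul_add]
            gcongr
            rw [hsub]; nlinarith
          have i2 : 0 ≤ (K * s * (a : ℝ) ^ 2 / n) * (K * s * ((q - a : ℕ) : ℝ) ^ 2 / n) := by
            positivity
          linarith
        calc _ ≤ mpCol n N a * mpRow n N (q - a) * ((1 - K * s * (a : ℝ) ^ 2 / n) *
              (1 - K * s * ((q - a : ℕ) : ℝ) ^ 2 / n)) := by gcongr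
          _ = _ := by ring
      have hfin := hrec q
      rw [Finset.sum_sub_distrib] at hfin
      refine le_trans ?_ hfin
      have hR := (mpRow_pos hn hN (q + 1)).le
      have hstep : K * s * (q : ℝ) ^ 2 / n + s * (K * (q + 1) / n) ≤
          K * s * ((q : ℝ) + 1) ^ 2 / n := by
        have : K * s * (q : ℝ) ^ 2 / n + s * (K * (q + 1) / n) =
            K * s * ((q : ℝ) ^ 2 + (q + 1)) / n := by ring
        rw [this]
        gcongr
        nlinarith
      have := mul_le_mul_of_nonneg_left hstep hR
      linarith

/-! ### Domination of subgaussian moments -/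

theorem pow_mul_factorial_le_domMoment {C : ℝ} (hC : 0 ≤ C) (k : ℕ) :
    C ^ k * ((k + 1).factorial : ℝ) ≤ domMoment C (2 * (k + 1)) := by
  induction k with
  | zero => simp [domMoment]
  | succ k ih =>
    rw [show 2 * (k + 1 + 1) = 2 * (k + 1) + 2 by ring, domMoment, if_neg (by omega),
      Nat.factorial_succ]
    have h0 : 0 ≤ C ^ k * ((k + 1).factorial : ℝ) := by positivity
    calc C ^ (k + 1) * (((k + 1 + 1) * (k + 1).factorial : ℕ) : ℝ)
        = ((k : ℝ) + 2) * C * (C ^ k * ((k + 1).factorial : ℝ)) := by push_cast; ring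
      _ ≤ (((2 * (k + 1) : ℕ) : ℝ) + 1) * C * (C ^ k * ((k + 1).factorial : ℝ)) := by
          refine mul_le_mul_of_nonneg_right (mul_le_mul_of_nonneg_right ?_ hC) h0
          push_cast; linarith
      _ ≤ _ := by gcongr

theorem pow_self_le_exp_mul_factorial (m : ℕ) :
    (m : ℝ) ^ m ≤ Real.exp 1 ^ m * (m.factorial : ℝ) := by
  have h := Real.pow_div_factorial_le_exp (m : ℝ) (Nat.cast_nonneg m) m
  rw [div_le_iff₀ (by positivity)] at h
  rwa [← Real.exp_nat_mul, mul_one]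

theorem IsSymmetricLaw.integral_pow_odd {ν : Measure ℝ} (h : IsSymmetricLaw ν) (k : ℕ) :
    ∫ x, x ^ (2 * k + 1) ∂ν = 0 := by
  have h1 : ∫ x, x ^ (2 * k + 1) ∂ν = ∫ x, (-x) ^ (2 * k + 1) ∂ν := by
    conv_lhs => rw [← h]
    rw [integral_map (by fun_prop) (by fun_prop)]
  have h2 : ∀ x : ℝ, (-x) ^ (2 * k + 1) = -x ^ (2 * k + 1) := fun x => by
    rw [Odd.neg_pow ⟨k, rfl⟩]
  simp only [h2, integral_neg] at h1
  linarith

theorem IsSubgaussianLaw.integrable_pow {ν : Measure ℝ} [IsProbabilityMeasure ν]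
    (h : IsSubgaussianLaw ν) (k : ℕ) : Integrable (fun x : ℝ => x ^ k) ν := by
  obtain ⟨C, -, hk⟩ := h
  rcases k with _ | k
  · simp
  · have := (hk (k + 1) (by omega)).1
    refine this.mono (by fun_prop) (Eventually.of_forall fun x => ?_)
    simp

theorem integral_pow_nonneg_of_isSymmetricLaw {ν : Measure ℝ} (h : IsSymmetricLaw ν) (k : ℕ) :
    0 ≤ ∫ x, x ^ k ∂ν := by
  rcases Nat.even_or_odd' k with ⟨m, rfl | rfl⟩
  · exact integral_nonneg fun x => (even_two_mul m).pow_nonneg x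
  · rw [h.integral_pow_odd]

/-- Odd moments vanish on both sides, and the moments of order `0` and `2` must match exactly, since
they carry the leading term. For order `2m` with `m ≥ 2`, `m^m ≤ e^m m!` gives the bound `D^m m!`.
Only `m - 1` factors of the constant are available, so the constant is `D²`, and `m ≤ 2 (m - 1)`. -/
theorem exists_moment_le_domMoment {ν : Measure ℝ} [IsProbabilityMeasure ν]
    (hsymm : IsSymmetricLaw ν) (hsub : IsSubgaussianLaw ν) (hvar : ∫ x, x ^ 2 ∂ν = 1) :
    ∃ C : ℝ, 1 ≤ C ∧ ∀ k : ℕ, ∫ x, x ^ k ∂ν ≤ domMoment C k := by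
  obtain ⟨C, hC, hk⟩ := hsub
  set D : ℝ := max 1 (2 * C * Real.exp 1) with hD
  have hD1 : 1 ≤ D := le_max_left _ _
  refine ⟨D ^ 2, one_le_pow₀ hD1, fun k => ?_⟩
  rcases Nat.even_or_odd' k with ⟨m, rfl | rfl⟩
  swap
  · rw [hsymm.integral_pow_odd, domMoment_odd]
  rcases m with _ | _ | m
  · simp [domMoment]
  · simp [domMoment, hvar]
  refine le_trans ?_ (pow_mul_factorial_le_domMoment (by positivity) (m + 1))
  have h1 := (hk (2 * (m + 1 + 1)) (by omega)).2
  have h2 : ∫ x, |x| ^ (2 * (m + 1 + 1)) ∂ν = ∫ x, x ^ (2 * (m + 1 + 1)) ∂ν := by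
    refine integral_congr_ae (Eventually.of_forall fun x => ?_)
    exact (even_two_mul _).pow_abs x
  rw [h2] at h1
  have h3 : (((2 * (m + 1 + 1) : ℕ) : ℝ) / 2) = ((m + 2 : ℕ) : ℝ) := by push_cast; ring
  rw [h3, Real.rpow_natCast] at h1
  refine h1.trans ?_
  have h4 := pow_self_le_exp_mul_factorial (m + 2)
  calc (C * ((2 * (m + 1 + 1) : ℕ) : ℝ)) ^ (m + 2)
      = (2 * C) ^ (m + 2) * ((m + 2 : ℕ) : ℝ) ^ (m + 2) := by rw [← mul_pow]; push_cast; ring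
    _ ≤ (2 * C) ^ (m + 2) * (Real.exp 1 ^ (m + 2) * ((m + 2).factorial : ℝ)) := by gcongr
    _ = (2 * C * Real.exp 1) ^ (m + 2) * ((m + 2).factorial : ℝ) := by rw [mul_pow]; ring
    _ ≤ D ^ (m + 2) * ((m + 2).factorial : ℝ) := by gcongr; exact le_max_right _ _
    _ ≤ D ^ (2 * (m + 1)) * ((m + 2).factorial : ℝ) := by
        gcongr
        omega
    _ = _ := by rw [← pow_mul]

/-! ### From polynomials to expectations -/

section Expectation

open MvPolynomial

variable {σ Ω : Type*} [Fintype σ] [MeasurableSpace Ω]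

/-- By independence the joint law is a product measure, under which a monomial integrates to the
product of its moments. -/
theorem integral_aeval_eq_momentFunctional {ν : Measure ℝ} [IsProbabilityMeasure ν]
    (hν : ∀ k : ℕ, Integrable (fun x : ℝ => x ^ k) ν) {P : Measure Ω} [IsProbabilityMeasure P]
    {Y : σ → Ω → ℝ} (hlaw : ∀ e, HasLaw (Y e) ν P) (hindep : iIndepFun Y P)
    (f : MvPolynomial σ ℕ) :
    Integrable (fun ω => aeval (fun e => Y e ω) f) P ∧
      ∫ ω, aeval (fun e => Y e ω) f ∂P = momentFunctional (fun k => ∫ x, x ^ k ∂ν) f := by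
  induction f using MvPolynomial.induction_on_nat with
  | zero => simp
  | add f g hf hg =>
    simp only [map_add]
    exact ⟨hf.1.add hg.1, by rw [integral_add hf.1 hg.1, hf.2, hg.2]⟩
  | mono s =>
    have hpi : HasLaw (fun ω e => Y e ω) (Measure.pi fun _ => ν) P := hindep.hasLaw_pi hlaw
    have hint : Integrable (fun x : σ → ℝ => ∏ e, x e ^ s e) (Measure.pi fun _ => ν) :=
      Integrable.fintype_prod fun e => hν (s e)
    have hev : ∀ ω, aeval (fun e => Y e ω) (monomial s 1 : MvPolynomial σ ℕ) =
        ∏ e, Y e ω ^ s e := by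
      intro ω
      rw [aeval_monomial, map_one, one_mul, Finsupp.prod_fintype _ _ fun _ => pow_zero _]
    simp only [hev, momentFunctional, monomialFunctional_monomial_one]
    constructor
    · rw [← hpi.map_eq] at hint
      exact hint.comp_aemeasurable hpi.aemeasurable
    · have := hpi.integral_comp (f := fun x : σ → ℝ => ∏ e, x e ^ s e) hint.aestronglyMeasurable
      rw [← integral_fintype_prod_eq_prod (fun e (x : ℝ) => x ^ s e)]
      exact this

end Expectation

theorem aeval_trace_rowGram_pow {n N : ℕ} (M : Matrix (Fin n) (Fin N) ℝ) (p : ℕ) :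
    (sampleCov M ^ p).trace = (1 / (N : ℝ)) ^ p *
      MvPolynomial.aeval (fun e : Fin n × Fin N => M e.1 e.2)
        (rowGram (Fin n) (Fin N) ^ p).trace := by
  set φ : MvPolynomial (Fin n × Fin N) ℕ →+* ℝ :=
    (MvPolynomial.aeval (fun e : Fin n × Fin N => M e.1 e.2) :
      MvPolynomial (Fin n × Fin N) ℕ →ₐ[ℕ] ℝ).toRingHom with hφ
  have h1 : (rowGram (Fin n) (Fin N)).map φ = M * Mᵀ := by
    rw [rowGram, Matrix.map_mul, Matrix.transpose_map]
    have : (varMatrix (Fin n) (Fin N)).map φ = M := by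
      ext i j; simp [hφ, varMatrix_apply]
    rw [this]
  have h2 : (rowGram (Fin n) (Fin N) ^ p).map φ = (M * Mᵀ) ^ p := by
    rw [← h1]; exact map_pow φ.mapMatrix _ p
  have h3 : φ (rowGram (Fin n) (Fin N) ^ p).trace = ((M * Mᵀ) ^ p).trace := by
    rw [← h2]; simp [Matrix.trace, map_sum]
  rw [sampleCov, smul_pow, Matrix.trace_smul, ← h3, smul_eq_mul]
  rfl

/-! ### Two-sided bounds and conclusion -/

section Bounds

variable {ι κ : Type*} [Fintype ι] [Fintype κ] [DecidableEq ι] [DecidableEq κ] [Nonempty ι]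
  [Nonempty κ]

theorem momentFunctional_mono {σ : Type*} [Fintype σ] {μ μ' : ℕ → ℝ} (hμ : ∀ k, 0 ≤ μ k)
    (h : ∀ k, μ k ≤ μ' k) (f : MvPolynomial σ ℕ) :
    momentFunctional μ f ≤ momentFunctional μ' f :=
  monomialFunctional_mono (fun _ => Finset.prod_le_prod (fun _ _ => hμ _) fun _ _ => h _) f

theorem rowTrace_bounds {C r : ℝ} (hC : 1 ≤ C) (hr : 0 ≤ r)
    (hcard : (Fintype.card ι : ℝ) ≤ r * Fintype.card κ) {μ : ℕ → ℝ} (hμ : ∀ k, 0 ≤ μ k)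
    (h0 : μ 0 = 1) (h2 : μ 2 = 1) (hle : ∀ k, μ k ≤ domMoment C k) (q : ℕ)
    (hq : (q : ℝ) ^ 2 ≤ Fintype.card ι)
    (hqK : growthConst C r * Real.exp (growthConst C r * 2) * q ^ 2 ≤ Fintype.card ι) :
    mpRow (Fintype.card ι) (Fintype.card κ) q *
      (1 - growthConst C r * Real.exp (growthConst C r * 2) * q ^ 2 / Fintype.card ι) ≤
        rowTrace ι κ μ q ∧
    rowTrace ι κ μ q ≤ mpRow (Fintype.card ι) (Fintype.card κ) q *
      Real.exp (growthConst C r * q ^ 2 / Fintype.card ι) := by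
  have hC0 : 0 ≤ C := by linarith
  have hn : (0 : ℝ) < Fintype.card ι := by positivity
  have hN : (0 : ℝ) < Fintype.card κ := by positivity
  have hM0 : ∀ k, 0 ≤ domMoment C k := domMoment_nonneg hC0
  have hM1 : domMoment C 0 = 1 := by simp [domMoment]
  have hup : ∀ q : ℕ, (q : ℝ) ^ 2 ≤ Fintype.card ι → _ :=
    upper_of_recursion hn hN hC0 hr hcard (fun q => rowTrace_nonneg (ι := ι) (κ := κ) hM0 q)
      (rowTrace_zero hM1) (colTrace_zero hM1) (colTrace_succ _) (rowTrace_succ_le hC)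
  refine ⟨?_, ?_⟩
  · exact (lower_of_recursion hn hN hC0 hr hcard
      (fun q => rowTrace_nonneg (ι := ι) (κ := κ) hM0 q) (rowTrace_zero h0) (colTrace_zero h0)
      (colTrace_succ μ) hup (le_rowTrace_succ hC hμ h0 h2 hle) q hq hqK).1
  · exact (momentFunctional_mono hμ hle _).trans (hup q hq).1

end Bounds

theorem theorem4
    -- the common law of the entries: symmetric, subgaussian, of unit variance
    (ν : Measure ℝ) [IsProbabilityMeasure ν]
    (hsymm : IsSymmetricLaw ν) (hsub : IsSubgaussianLaw ν) (hvar : ∫ x, x ^ 2 ∂ν = 1)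
    -- the dimensions `N = N(n)` and the powers `p = p(n)`
    (γ : ℝ) (hγ : 0 < γ) (N p : ℕ → ℕ)
    (hN : Tendsto (fun n : ℕ => (n : ℝ) / (N n : ℝ)) atTop (𝓝 γ))
    (hp1 : ∀ n, 1 ≤ p n)
    (hp : (fun n : ℕ => (p n : ℝ)) =o[atTop] fun n : ℕ => (n : ℝ) ^ (1 / 2 : ℝ))
    -- for every `n`, a random `n × N(n)` matrix with i.i.d. entries of law `ν`
    {Ω : ℕ → Type*} [∀ n, MeasurableSpace (Ω n)]
    (P : ∀ n, Measure (Ω n)) [∀ n, IsProbabilityMeasure (P n)]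
    (X : ∀ n, Ω n → Matrix (Fin n) (Fin (N n)) ℝ)
    (hlaw : ∀ n i j, HasLaw (fun ω => X n ω i j) ν (P n))
    (hindep : ∀ n, iIndepFun
      (fun (ij : Fin n × Fin (N n)) (ω : Ω n) => X n ω ij.1 ij.2) (P n)) :
    (∀ n, Integrable (fun ω => (sampleCov (X n ω) ^ p n).trace) (P n)) ∧
    (∃ δ : ℕ → ℝ,
      δ =O[atTop] (fun n : ℕ => (p n : ℝ) ^ 2 / (n : ℝ)) ∧
      ∀ᶠ n : ℕ in atTop,
        ∫ ω, (sampleCov (X n ω) ^ p n).trace ∂(P n) =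
          (n : ℝ) * mpMoment (p n) ((n : ℝ) / (N n : ℝ)) * (1 + δ n)) ∧
    (∀ k : ℕ, 1 ≤ k → ∀ c : ℝ, 0 < c →
      mpMoment k c = ∑ r ∈ Finset.range k,
        1 / ((r : ℝ) + 1) * (k.choose r : ℝ) * ((k - 1).choose r : ℝ) * c ^ r) := by
  have hexp : ∀ n, Integrable (fun ω => (sampleCov (X n ω) ^ p n).trace) (P n) ∧
      ∫ ω, (sampleCov (X n ω) ^ p n).trace ∂(P n) = (1 / (N n : ℝ)) ^ p n *
        rowTrace (Fin n) (Fin (N n)) (fun k => ∫ x, x ^ k ∂ν) (p n) := by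
    intro n
    have h := integral_aeval_eq_momentFunctional hsub.integrable_pow
      (fun e : Fin n × Fin (N n) => hlaw n e.1 e.2) (hindep n)
      (rowGram (Fin n) (Fin (N n)) ^ p n).trace
    simp only [aeval_trace_rowGram_pow]
    exact ⟨h.1.const_mul _, by rw [integral_const_mul, h.2, rowTrace]⟩
  refine ⟨fun n => (hexp n).1, ?_, fun k hk c hc => mpMoment_eq_sum hc hk⟩
  obtain ⟨C, hC, hle⟩ := exists_moment_le_domMoment hsymm hsub hvar
  have hr : 0 ≤ 2 * γ := by linarith
  set K := growthConst C (2 * γ) with hK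
  have hK0 : 0 ≤ K := growthConst_nonneg (by linarith) hr
  set L := K * Real.exp (K * 2) with hL
  have hL0 : 0 ≤ L := by positivity
  set E : ℕ → ℝ := fun n => ∫ ω, (sampleCov (X n ω) ^ p n).trace ∂(P n) with hE
  set m : ℕ → ℝ := fun n => (n : ℝ) * mpMoment (p n) ((n : ℝ) / (N n : ℝ)) with hm
  have hmain : ∀ᶠ n : ℕ in atTop, 0 < m n ∧
      |E n / m n - 1| ≤ L * ((p n : ℝ) ^ 2 / n) := by
    -- This threshold in `p = o(√n)` yields `(1 + L) p² ≤ n`, hence both size conditions `p² ≤ n`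
    -- and `L p² ≤ n`.
    have hc : (0 : ℝ) < 1 / (1 + L) := by positivity
    filter_upwards [hp.def hc, hN.eventually (lt_mem_nhds (show γ / 2 < γ by linarith)),
      hN.eventually (gt_mem_nhds (show γ < 2 * γ by linarith)), eventually_ge_atTop 1]
      with n h1 h2 h3 h4
    have hn : (0 : ℝ) < n := by exact_mod_cast h4
    -- If `N n` were `0`, the quotient `n / N n` would be `0` by convention, contradicting its
    -- closeness to `γ`.
    have hNn : (0 : ℝ) < N n := by
      rcases Nat.eq_zero_or_pos (N n) with h | h
      · rw [h] at h2; simp at h2; linarith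
      · exact_mod_cast h
    have hc0 : 0 < (n : ℝ) / N n := by positivity
    have hp2 : (p n : ℝ) ^ 2 ≤ 1 / (1 + L) * n := by
      rw [Real.norm_of_nonneg (by positivity), Real.norm_of_nonneg (by positivity),
        ← Real.sqrt_eq_rpow] at h1
      have hcl : 1 / (1 + L) ≤ 1 := by rw [div_le_one (by positivity)]; linarith
      calc (p n : ℝ) ^ 2 ≤ (1 / (1 + L) * √(n : ℝ)) ^ 2 := by gcongr
        _ = (1 / (1 + L)) * (1 / (1 + L)) * n := by rw [mul_pow, Real.sq_sqrt hn.le]; ring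
        _ ≤ 1 * (1 / (1 + L)) * n := by gcongr
        _ = _ := by ring
    have hLp : (1 + L) * (p n : ℝ) ^ 2 ≤ n := by
      calc (1 + L) * (p n : ℝ) ^ 2 ≤ (1 + L) * (1 / (1 + L) * n) := by gcongr
        _ = n := by field_simp
    have hp0 : 0 ≤ (p n : ℝ) ^ 2 := sq_nonneg _
    have hLp0 := mul_nonneg hL0 hp0
    have : Nonempty (Fin n) := ⟨⟨0, h4⟩⟩
    have : Nonempty (Fin (N n)) := ⟨⟨0, by exact_mod_cast hNn⟩⟩
    obtain ⟨hlo, hup⟩ := rowTrace_bounds (ι := Fin n) (κ := Fin (N n)) hC hr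
      (by simp only [Fintype.card_fin]; rw [div_lt_iff₀ hNn] at h3; exact h3.le)
      (integral_pow_nonneg_of_isSymmetricLaw hsymm) (by simp) hvar hle (p n)
      (by simp only [Fintype.card_fin]; linarith) (by simp only [Fintype.card_fin]; linarith)
    simp only [Fintype.card_fin, ← hK, ← hL] at hlo hup
    have hmn : m n = n * mpSeq ((n : ℝ) / N n) (p n) := by
      obtain ⟨k, hk⟩ := Nat.exists_eq_add_of_le' (hp1 n)
      simp only [hm]
      rw [hk, mpMoment_eq_mpSeq hc0]
    have hm0 : 0 < m n := by rw [hmn]; exact mul_pos hn (mpSeq_pos hc0 _)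
    have hrow : mpRow n (N n) (p n) = (N n : ℝ) ^ p n * m n := by rw [mpRow, hmn]; ring
    have hET : rowTrace (Fin n) (Fin (N n)) (fun k => ∫ x, x ^ k ∂ν) (p n) =
        (N n : ℝ) ^ p n * E n := by
      simp only [hE]
      rw [(hexp n).2, ← mul_assoc, ← mul_pow, mul_one_div_cancel hNn.ne', one_pow, one_mul]
    rw [hrow, hET, mul_assoc] at hlo hup
    have hNp : 0 < (N n : ℝ) ^ p n := by positivity
    have hlo' := le_of_mul_le_mul_left hlo hNp
    have hup' := le_of_mul_le_mul_left hup hNp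
    refine ⟨hm0, ?_⟩
    set t := (p n : ℝ) ^ 2 / n with ht
    have ht0 : 0 ≤ t := by positivity
    have ht1 : t ≤ 1 := by rw [ht, div_le_one hn]; linarith
    rw [mul_div_assoc] at hlo' hup'
    -- From `exp x - 1 ≤ x exp x` with `x = K t` and `t ≤ 1`; the upper error then has the same
    -- constant `L` as the lower one.
    have hKt : Real.exp (K * t) - 1 ≤ L * t := by
      have h5 := Real.add_one_le_exp (-(K * t))
      have h6 : Real.exp (K * t) * Real.exp (-(K * t)) = 1 := by
        rw [← Real.exp_add]; simp
      have h7 : Real.exp (K * t) ≤ Real.exp (K * 2) := by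
        rw [Real.exp_le_exp]; exact mul_le_mul_of_nonneg_left (by linarith) hK0
      have h8 := mul_le_mul_of_nonneg_left h5 (Real.exp_pos (K * t)).le
      have h9 := mul_le_mul_of_nonneg_right h7 (mul_nonneg hK0 ht0)
      calc Real.exp (K * t) - 1 ≤ Real.exp (K * t) * (K * t) := by linarith
        _ ≤ Real.exp (K * 2) * (K * t) := h9
        _ = L * t := by rw [hL]; ring
    rw [abs_le]
    constructor
    · have : 1 - L * t ≤ E n / m n := by rw [le_div_iff₀ hm0]; linarith
      linarith
    · have : E n / m n ≤ Real.exp (K * t) := by rw [div_le_iff₀ hm0]; linarith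
      linarith
  refine ⟨fun n => E n / m n - 1, ?_, ?_⟩
  · refine IsBigO.of_bound L ?_
    filter_upwards [hmain] with n h
    rw [Real.norm_eq_abs, Real.norm_of_nonneg (by positivity)]
    exact h.2
  · filter_upwards [hmain] with n h
    change E n = m n * (1 + (E n / m n - 1))
    rw [add_sub_cancel, mul_div_cancel₀ _ h.1.ne']
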